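/- Notation. For a real matrix $M$ let $\|M\|_{\max}=\max_{i,j}|M_{ij}|$, $\|M\|_1=\max_j\sum_i|M_{ij}|$, let $\|M\|_2$ be the spectral norm, $\sigma_{\min}(M)$ the smallest singular value, and $M^+$ the Moore–Penrose inverse. For a positive definite $\Sigma\in\mathbb{R}^{d\times d}$, a random matrix $X\in\mathbb{R}^{n\times d}$ is drawn from the $\Sigma$-Gaussian ensemble if its rows are independent with law $\mathcal N(0,\Sigma)$. For $A\subseteq\{1,\dots,d\}$ let $A^c$ be its complement, $X_A$ the matrix of the columns of $X$ with index in $A$, and $\Sigma_{A|A^c}=\Sigma_{AA}-\Sigma_{AA^c}(\Sigma_{A^cA^c})^{-1}\Sigma_{A^cA}$. Square roots of matrices are positive semidefinite square roots. Statement. (i) Let $X$ be drawn from the $\Sigma$-Gaussian ensemble, $\Sigma\succ0$, let $|A|\le n$ and $\delta\in(2e^{-n/2},1)$. Then $\Sigma_{A|A^c}\succ0$, and if the denominator below is positive, then $$\mathbb P\left[\|X\|_{\max}\|X_A^+\|_2\le\frac{\|\sqrt\Sigma\|_1\sqrt{2\ln(4nd/\delta)}}{\big(\sqrt n-\sqrt{2\ln(2/\delta)}\big)\,\sigma_{\min}\big(\sqrt{\Sigma_{A|A^c}}\big)-\sqrt{\operatorname{Tr}\Sigma_{A|A^c}}}\right]\ge1-\delta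 .$$ (ii) In particular, if $\Sigma=I$, $|A|\le n/2$, $\delta\in(2e^{-n/2},1)$ and the denominator below is positive, then $$\mathbb P\left[\|X\|_{\max}\|X_A^+\|_2\le\frac{\sqrt{2\ln(4nd/\delta)}}{(1-1/\sqrt2)\sqrt n-\sqrt{2\ln(2/\delta)}}\right]\ge1-\delta .$$ (iii) Consequently the quantity is $O(\sqrt{\ln(nd/\delta)/n})$ for $\Sigma=I$ and $|A|\le n/2$: for every $\kappa<1-1/\sqrt2$ there is a constant $C>0$, depending only on $\kappa$, such that for all $n,d$, all $A$ with $|A|\le n/2$ and all $\delta\in(2e^{-n/2},1)$ with $\sqrt{2\ln(2/\delta)}\le\kappa\sqrt n$, if $X$ is drawn from the $I$-Gaussian ensemble, then $\mathbb P\big[\|X\|_{\max}\|X_A^+\|_2\le C\sqrt{\ln(nd/\delta)/n}\big]\ge1-\delta$. -/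

import Mathlib

open MeasureTheory ProbabilityTheory
open scoped MatrixOrder

noncomputable section

namespace LassoGaussian

/-- `‖M‖_max`, the largest absolute value of an entry (`0` for a matrix without entries). -/
def maxNorm {m k : Type*} (M : Matrix m k ℝ) : ℝ :=
  ⨆ i, ⨆ j, |M i j|

/-- `‖M‖₁`, the operator norm for the `ℓ¹` norms, i.e. the largest absolute column sum. -/
def oneNorm {m k : Type*} [Fintype m] (M : Matrix m k ℝ) : ℝ :=
  ⨆ j, ∑ i, |M i j|

/-- `‖M‖₂`, the spectral norm: the operator norm for the Euclidean norms. -/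
def specNorm {m k : Type*} [Fintype m] [Fintype k] [DecidableEq k] (M : Matrix m k ℝ) : ℝ :=
  ‖(Matrix.toEuclideanLin M).toContinuousLinearMap‖

/-- `σ_min(M)`, the last of the `k` singular values of a matrix with `k` columns (Mathlib lists
them in decreasing order, starting with index `0`). -/
def sigmaMin {m k : Type*} [Fintype m] [Fintype k] [DecidableEq k] (M : Matrix m k ℝ) : ℝ :=
  (Matrix.toEuclideanLin M).singularValues (Fintype.card k - 1)

/-- The Penrose equations: `B` is the Moore-Penrose inverse of `M`. -/
structure IsMoorePenrose {m k : Type*} [Fintype m] [Fintype k]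
    (M : Matrix m k ℝ) (B : Matrix k m ℝ) : Prop where
  mul_mul_self : M * B * M = M
  mul_mul_inv : B * M * B = B
  left_symm : (M * B).transpose = M * B
  right_symm : (B * M).transpose = B * M

/-- The Moore-Penrose inverse, as `(Mᵀ M)⁺ Mᵀ`, where the pseudoinverse of the symmetric
matrix `Mᵀ M` inverts its nonzero eigenvalues and keeps the eigenvalue `0` (recall `0⁻¹ = 0`).
See `isMoorePenrose_pinv` and `IsMoorePenrose.eq_pinv` below. -/
def pinv {m k : Type*} [Fintype m] [Fintype k] [DecidableEq k] (M : Matrix m k ℝ) :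
    Matrix k m ℝ :=
  cfc (fun x : ℝ => x⁻¹) (M.transpose * M) * M.transpose

theorem isMoorePenrose_pinv {m k : Type*} [Fintype m] [Fintype k] [DecidableEq k]
    (M : Matrix m k ℝ) : IsMoorePenrose M (pinv M) := by
  set G : Matrix k k ℝ := M.transpose * M with hG
  set N : Matrix k k ℝ := cfc (fun x : ℝ => x⁻¹) G with hN
  have hpinv : pinv M = N * M.transpose := rfl
  have hGsa : IsSelfAdjoint G := by
    have h := (Matrix.isHermitian_conjTranspose_mul_self M).isSelfAdjoint
    rwa [Matrix.conjTranspose_eq_transpose_of_trivial] at h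
  have hcont : ∀ f : ℝ → ℝ, ContinuousOn f (spectrum ℝ G) := fun f =>
    (Matrix.finite_real_spectrum (A := G)).continuousOn f
  have hNsa : N.transpose = N := by
    have h : IsSelfAdjoint N := cfc_predicate _ _
    rw [← Matrix.conjTranspose_eq_transpose_of_trivial]
    exact h
  have hGt : G.transpose = G := by
    rw [hG, Matrix.transpose_mul, Matrix.transpose_transpose]
  have hcomm : N * G = G * N := (cfc_commute_cfc (fun x : ℝ => x⁻¹) id G).eq.trans
    (by rw [cfc_id ℝ G]) |> fun h => by rwa [cfc_id ℝ G] at h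
  have hNG : N * G = cfc (fun x : ℝ => x⁻¹ * x) G := by
    rw [cfc_mul (fun x : ℝ => x⁻¹) (fun x => x) G (hcont _) (hcont _), cfc_id' ℝ G]
  have hGNG : G * (N * G) = G := by
    rw [hNG]
    conv_lhs => rw [← cfc_id' ℝ G]
    rw [cfc_id' ℝ G]
    nth_rewrite 1 [← cfc_id' ℝ G]
    rw [← cfc_mul (fun x : ℝ => x) (fun x : ℝ => x⁻¹ * x) G (hcont _) (hcont _)]
    conv_rhs => rw [← cfc_id' ℝ G]
    congr 1
    funext x
    by_cases hx : x = 0 <;> simp [hx]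
  have hNGN : N * G * N = N := by
    rw [hNG, hN, ← cfc_mul (fun x : ℝ => x⁻¹ * x) (fun x : ℝ => x⁻¹) G (hcont _) (hcont _)]
    congr 1
    funext x
    by_cases hx : x = 0 <;> simp [hx]
  have hMNG : M * (N * G) = M := by
    have h0 : G * (N * G - 1) = 0 := by rw [mul_sub, hGNG, mul_one, sub_self]
    have h1 : M * (N * G - 1) = 0 := by
      rw [← Matrix.conjTranspose_mul_self_eq_zero]
      rw [Matrix.conjTranspose_eq_transpose_of_trivial, Matrix.transpose_mul,
        Matrix.mul_assoc, ← Matrix.mul_assoc M.transpose, ← hG, h0, Matrix.mul_zero]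
    rw [Matrix.mul_sub, Matrix.mul_one] at h1
    exact sub_eq_zero.mp h1
  have hright : pinv M * M = N * G := by rw [hpinv, Matrix.mul_assoc]
  refine ⟨?_, ?_, ?_, ?_⟩
  · rw [Matrix.mul_assoc, hright, hMNG]
  · rw [hright, hpinv, ← Matrix.mul_assoc, hNGN]
  · rw [hpinv, Matrix.transpose_mul, Matrix.transpose_mul, Matrix.transpose_transpose, hNsa,
      Matrix.mul_assoc]
  · rw [hright, Matrix.transpose_mul, hNsa, hGt, hcomm]

theorem IsMoorePenrose.eq_pinv {m k : Type*} [Fintype m] [Fintype k] [DecidableEq k]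
    {M : Matrix m k ℝ} {B : Matrix k m ℝ} (hB : IsMoorePenrose M B) : B = pinv M := by
  have hP := isMoorePenrose_pinv M
  set C := pinv M
  have h1 : M * B = M * C := by
    calc M * B = (M * B).transpose := hB.left_symm.symm
      _ = ((M * C) * (M * B)).transpose := by
          rw [← Matrix.mul_assoc, hP.mul_mul_self]
      _ = (M * B) * (M * C) := by
          rw [Matrix.transpose_mul, hB.left_symm, hP.left_symm]
      _ = M * C := by rw [← Matrix.mul_assoc, hB.mul_mul_self]
  have h2 : B * M = C * M := by
    calc B * M = (B * M).transpose := hB.right_symm.symm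
      _ = ((B * M) * (C * M)).transpose := by
          rw [Matrix.mul_assoc, ← Matrix.mul_assoc M, hP.mul_mul_self]
      _ = (C * M) * (B * M) := by
          rw [Matrix.transpose_mul, hB.right_symm, hP.right_symm]
      _ = C * M := by rw [Matrix.mul_assoc, ← Matrix.mul_assoc M, hB.mul_mul_self]
  calc B = B * M * B := hB.mul_mul_inv.symm
    _ = C * (M * B) := by rw [h2, Matrix.mul_assoc]
    _ = C := by rw [h1, ← Matrix.mul_assoc, hP.mul_mul_inv]

/-- `X_𝒜`: the columns of `X` with index in `𝒜`. -/
def colSub {m : Type*} {d : ℕ} (X : Matrix m (Fin d) ℝ) (𝒜 : Finset (Fin d)) : Matrix m 𝒜 ℝ :=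
  X.submatrix id (fun j => (j : Fin d))

/-- `S_{𝒜ℬ}`: the rows of `S` with index in `𝒜` and the columns with index in `ℬ`. -/
def block {d : ℕ} (S : Matrix (Fin d) (Fin d) ℝ) (𝒜 ℬ : Finset (Fin d)) : Matrix 𝒜 ℬ ℝ :=
  S.submatrix (fun i => (i : Fin d)) (fun j => (j : Fin d))

/-- The conditional covariance matrix
`S_{𝒜|𝒜ᶜ} = S_{𝒜𝒜} - S_{𝒜𝒜ᶜ} (S_{𝒜ᶜ𝒜ᶜ})⁻¹ S_{𝒜ᶜ𝒜}`. -/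
def condCov {d : ℕ} (S : Matrix (Fin d) (Fin d) ℝ) (𝒜 : Finset (Fin d)) : Matrix 𝒜 𝒜 ℝ :=
  block S 𝒜 𝒜 - block S 𝒜 𝒜ᶜ * (block S 𝒜ᶜ 𝒜ᶜ)⁻¹ * block S 𝒜ᶜ 𝒜

/-- The random matrix `X` is drawn from the `S`-Gaussian ensemble: its rows are independent and
each has the law `𝒩(0, S)`. -/
structure IsGaussianEnsemble {Ω : Type*} [MeasurableSpace Ω] {n d : ℕ}
    (X : Ω → Matrix (Fin n) (Fin d) ℝ) (S : Matrix (Fin d) (Fin d) ℝ) (P : Measure Ω) :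
    Prop where
  indep : iIndepFun (fun (i : Fin n) (ω : Ω) => WithLp.toLp 2 (X ω i)) P
  law : ∀ i : Fin n, HasLaw (fun ω => WithLp.toLp 2 (X ω i)) (multivariateGaussian 0 S) P

end LassoGaussian

end

/-! The maximum of the entries and the pseudoinverse are bounded on two events, each failing with
probability at most `δ / 2`. Entry `(i, j)` is Gaussian with variance `S j j`, and `S j j` is at
most `‖√S‖₁ ^ 2`, so a union bound over the `n d` entries controls `‖X‖_max`. If `‖X_A u‖ ≥ D ‖u‖`
for all `u`, then `‖X_A⁺‖₂ ≤ D⁻¹`, because `X_A X_A⁺` is an orthogonal projection.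

For this lower bound write `X = G √S` with `G` standard Gaussian, so that `X_A u = G R u`, where `R`
consists of the columns of `√S` in `A`. The vectors `R u` fill a space of dimension `|A|`, on which
`‖G v‖ ≥ (√n - √|A| - t) ‖v‖` outside an event of probability `exp (-t² / 2)`
(`measureReal_gaussian_lower_bound_fails_le`). Moreover `‖R u‖² = uᵀ S_AA u ≥ uᵀ S_{A|Aᶜ} u ≥ σ²
‖u‖²` with `σ = σ_min(√S_{A|Aᶜ})`, and `√|A| σ ≤ √Tr S_{A|Aᶜ}`. This yields the stated denominator.

The estimate for `G` is an exponential-moment form of Gordon's inequality: for unit vectors `v` and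
independent standard Gaussian `γ`, `g`, `h`, `E exp (-l min_v (‖G v‖ + γ)) ≤ E exp (-l min_v (‖g‖ +
⟨h, v⟩))`. It follows from Gaussian interpolation applied to a soft minimum
(`integral_comp_le_of_sum_fderiv_le`, `sum_softHess_gordon_le`). The right side factors into
exponential moments of `-‖g‖` and of `‖P h‖`, with `P` the projection onto the subspace. These are
bounded by Stein's identity under exponential tilts (`mgf_neg_smoothNorm_le`,
`mgf_smoothNorm_mulVec_le`), so no separate concentration theorem enters.

Norms are smoothed by `ε > 0`, which makes them differentiable with bounded inverse; `smoothNorm 0`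
is the Euclidean norm itself. -/

namespace LassoGaussian

/-! ### Gaussian integration by parts. -/

/-- The standard Gaussian measure on `ι → ℝ`. -/
noncomputable abbrev stdGauss (ι : Type*) [Fintype ι] : Measure (ι → ℝ) :=
  Measure.pi fun _ => gaussianReal 0 1

/-- Continuous functions with at most exponential growth. -/
structure ExpGrowth {ι : Type*} [Fintype ι] (f : (ι → ℝ) → ℝ) : Prop where
  continuous : Continuous f
  bound : ∃ C c : ℝ, 0 ≤ C ∧ 0 ≤ c ∧ ∀ w, |f w| ≤ C * Real.exp (c * ∑ i, |w i|)

theorem integrable_exp_sum_abs (ι : Type*) [Fintype ι] (c : ℝ) :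
    Integrable (fun w : ι → ℝ => Real.exp (c * ∑ i, |w i|)) (stdGauss ι) := by
  have h : ∀ t : ℝ, Integrable (fun x : ℝ => Real.exp (t * |x|)) (gaussianReal 0 1) := fun t =>
    integrable_exp_mul_abs (X := fun x : ℝ => x) (integrable_exp_mul_gaussianReal t)
      (integrable_exp_mul_gaussianReal (-t))
  have h2 := Integrable.fintype_prod (f := fun (_ : ι) (x : ℝ) => Real.exp (c * |x|))
    (μ := fun _ : ι => gaussianReal 0 1) (fun _ => h c)
  refine h2.congr (Filter.Eventually.of_forall fun w => ?_)
  simp only [Finset.mul_sum, Real.exp_sum]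

namespace ExpGrowth

variable {ι : Type*} [Fintype ι] {f g : (ι → ℝ) → ℝ}

theorem integrable (hf : ExpGrowth f) : Integrable f (stdGauss ι) := by
  obtain ⟨C, c, -, -, h⟩ := hf.bound
  exact ((integrable_exp_sum_abs ι c).const_mul C).mono' hf.continuous.aestronglyMeasurable
    (Filter.Eventually.of_forall h)

theorem of_le (hf : Continuous f) (hg : ExpGrowth g) (h : ∀ w, |f w| ≤ |g w|) : ExpGrowth f := by
  obtain ⟨C, c, hC, hc, hb⟩ := hg.bound
  exact ⟨hf, C, c, hC, hc, fun w => (h w).trans (hb w)⟩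

theorem const (a : ℝ) : ExpGrowth (fun _ : ι → ℝ => a) :=
  ⟨continuous_const, |a|, 0, abs_nonneg _, le_rfl, fun w => by simp⟩

theorem exp_sum_abs (c : ℝ) : ExpGrowth (fun w : ι → ℝ => Real.exp (c * ∑ i, |w i|)) := by
  refine ⟨by fun_prop, 1, |c|, zero_le_one, abs_nonneg c, fun w => ?_⟩
  rw [abs_of_pos (Real.exp_pos _), one_mul]
  exact Real.exp_le_exp.2 (mul_le_mul_of_nonneg_right (le_abs_self c)
    (Finset.sum_nonneg fun _ _ => abs_nonneg _))

theorem sum_abs : ExpGrowth (fun w : ι → ℝ => ∑ i, |w i|) := by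
  refine of_le (by fun_prop) (exp_sum_abs 1) fun w => ?_
  rw [abs_of_nonneg (Finset.sum_nonneg fun _ _ => abs_nonneg _), abs_of_pos (Real.exp_pos _),
    one_mul]
  linarith [Real.add_one_le_exp (∑ i, |w i|)]

theorem add (hf : ExpGrowth f) (hg : ExpGrowth g) : ExpGrowth (fun w => f w + g w) := by
  obtain ⟨C, c, hC, hc, hb⟩ := hf.bound
  obtain ⟨D, d, hD, hd, hb'⟩ := hg.bound
  refine ⟨hf.continuous.add hg.continuous, C + D, c + d, by positivity, by positivity,
    fun w => ?_⟩
  have hs : 0 ≤ ∑ i, |w i| := Finset.sum_nonneg fun _ _ => abs_nonneg _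
  have h1 : Real.exp (c * ∑ i, |w i|) ≤ Real.exp ((c + d) * ∑ i, |w i|) :=
    Real.exp_le_exp.2 (mul_le_mul_of_nonneg_right (by linarith) hs)
  have h2 : Real.exp (d * ∑ i, |w i|) ≤ Real.exp ((c + d) * ∑ i, |w i|) :=
    Real.exp_le_exp.2 (mul_le_mul_of_nonneg_right (by linarith) hs)
  calc |f w + g w| ≤ |f w| + |g w| := abs_add_le _ _
    _ ≤ C * Real.exp (c * ∑ i, |w i|) + D * Real.exp (d * ∑ i, |w i|) := add_le_add (hb w) (hb' w)
    _ ≤ _ := by rw [add_mul]; gcongr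

theorem mul (hf : ExpGrowth f) (hg : ExpGrowth g) : ExpGrowth (fun w => f w * g w) := by
  obtain ⟨C, c, hC, hc, hb⟩ := hf.bound
  obtain ⟨D, d, hD, hd, hb'⟩ := hg.bound
  refine ⟨hf.continuous.mul hg.continuous, C * D, c + d, by positivity, by positivity,
    fun w => ?_⟩
  rw [abs_mul, add_mul, Real.exp_add]
  calc |f w| * |g w| ≤ (C * Real.exp (c * ∑ i, |w i|)) * (D * Real.exp (d * ∑ i, |w i|)) :=
        mul_le_mul (hb w) (hb' w) (abs_nonneg _) (by positivity)
    _ = _ := by ring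

theorem sum {κ : Type*} (s : Finset κ) {F : κ → (ι → ℝ) → ℝ} (h : ∀ k ∈ s, ExpGrowth (F k)) :
    ExpGrowth (fun w => ∑ k ∈ s, F k w) := by
  classical
  induction s using Finset.induction_on with
  | empty => simpa using const (0 : ℝ)
  | insert a s ha ih =>
    simp only [Finset.sum_insert ha]
    exact (h a (Finset.mem_insert_self _ _)).add
      (ih fun k hk => h k (Finset.mem_insert_of_mem hk))

theorem apply (i : ι) : ExpGrowth (fun w : ι → ℝ => w i) :=
  of_le (by fun_prop) sum_abs fun w => by
    rw [abs_of_nonneg (a := ∑ i, |w i|) (Finset.sum_nonneg fun _ _ => abs_nonneg _)]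
    exact Finset.single_le_sum (f := fun i => |w i|) (fun _ _ => abs_nonneg _) (Finset.mem_univ i)

end ExpGrowth

variable {ι : Type*} [Fintype ι] [DecidableEq ι]

/-- Resampling one coordinate independently does not change a product law. This reduces Stein's
lemma to dimension one without splitting the index type. -/
theorem measurePreserving_update (i : ι) :
    MeasurePreserving (fun p : (ι → ℝ) × ℝ => Function.update p.1 i p.2)
      ((stdGauss ι).prod (gaussianReal 0 1)) (stdGauss ι) := by
  have hm : Measurable (fun p : (ι → ℝ) × ℝ => Function.update p.1 i p.2) := by
    refine measurable_pi_lambda _ fun j => ?_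
    by_cases h : j = i
    · subst h; simpa using measurable_snd
    · simp only [Function.update_of_ne h]
      fun_prop
  refine ⟨hm, (Measure.pi_eq fun s hs => ?_).symm⟩
  rw [Measure.map_apply hm (MeasurableSet.univ_pi hs)]
  have : (fun p : (ι → ℝ) × ℝ => Function.update p.1 i p.2) ⁻¹' (Set.univ.pi s) =
      (Set.univ.pi (Function.update s i Set.univ)) ×ˢ s i := by
    ext p
    simp only [Set.mem_preimage, Set.mem_pi, Set.mem_univ, true_implies, Set.mem_prod]
    constructor
    · intro h
      refine ⟨fun j => ?_, by simpa using h i⟩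
      by_cases hj : j = i
      · subst hj; simp
      · simpa [Function.update_of_ne hj] using h j
    · rintro ⟨h, h'⟩ j
      by_cases hj : j = i
      · subst hj; simpa using h'
      · simpa [Function.update_of_ne hj] using h j
  rw [this, Measure.prod_prod, Measure.pi_pi,
    ← Finset.mul_prod_erase _ _ (Finset.mem_univ i),
    ← Finset.mul_prod_erase (Finset.univ) (fun j => gaussianReal 0 1 (s j)) (Finset.mem_univ i)]
  simp only [Function.update_self, measure_univ, one_mul]
  rw [mul_comm]
  congr 1
  refine Finset.prod_congr rfl fun j hj => ?_
  rw [Function.update_of_ne (Finset.ne_of_mem_erase hj)]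

/-- Stein's lemma in dimension one. -/
theorem integral_id_mul_gaussianReal {f f' : ℝ → ℝ} (hf : ∀ x, HasDerivAt f (f' x) x)
    (hfi : Integrable f (gaussianReal 0 1)) (hxf : Integrable (fun x => x * f x) (gaussianReal 0 1))
    (hf' : Integrable f' (gaussianReal 0 1)) :
    ∫ x, x * f x ∂(gaussianReal 0 1) = ∫ x, f' x ∂(gaussianReal 0 1) := by
  -- The Gaussian density satisfies `p' = -x p`, so the claim is integration by parts of `f` against
  -- `p'`.
  have hp : ∀ x, HasDerivAt (gaussianPDFReal 0 1) (-x * gaussianPDFReal 0 1 x) x := by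
    intro x
    have h1 : HasDerivAt (fun x : ℝ => -x ^ 2 / 2) (-x) x := by
      convert! ((hasDerivAt_pow 2 x).neg.div_const 2) using 1
      simp; ring
    have h2 := (h1.exp).const_mul ((√(2 * Real.pi * 1))⁻¹)
    convert! h2 using 1
    · funext y; simp [gaussianPDFReal]
    · simp [gaussianPDFReal]; ring
  have key : ∀ g : ℝ → ℝ, Integrable g (gaussianReal 0 1) →
      Integrable (g * gaussianPDFReal 0 1) := by
    intro g hg
    rw [gaussianReal_of_var_ne_zero 0 one_ne_zero] at hg
    rw [integrable_withDensity_iff (measurable_gaussianPDF 0 1)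
      (Filter.Eventually.of_forall fun _ => gaussianPDF_lt_top)] at hg
    simpa [toReal_gaussianPDF, Pi.mul_def] using hg
  have h := integral_mul_deriv_eq_deriv_mul_of_integrable (u := f) (v := gaussianPDFReal 0 1)
    (u' := f') (v' := fun x => -x * gaussianPDFReal 0 1 x) (fun x _ => hf x) (fun x _ => hp x)
    (by
      have := (key _ hxf).neg
      refine this.congr (Filter.Eventually.of_forall fun x => ?_)
      simp; ring) (key _ hf') (key _ hfi)
  rw [integral_gaussianReal_eq_integral_smul one_ne_zero,
    integral_gaussianReal_eq_integral_smul one_ne_zero]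
  simp only [smul_eq_mul]
  have e1 : ∫ x, gaussianPDFReal 0 1 x * (x * f x) = -∫ x, f x * (-x * gaussianPDFReal 0 1 x) := by
    rw [← integral_neg]; congr 1; funext x; ring
  rw [e1, h, neg_neg]
  congr 1; funext x; ring

/-- Stein's lemma for the standard Gaussian measure on `ι → ℝ`. -/
theorem integral_apply_mul_stdGauss {f f' : (ι → ℝ) → ℝ} (i : ι) (hf : ExpGrowth f)
    (hf' : ExpGrowth f')
    (hd : ∀ w, HasDerivAt (fun s : ℝ => f (w + s • Pi.single i 1)) (f' w) 0) :
    ∫ w, w i * f w ∂(stdGauss ι) = ∫ w, f' w ∂(stdGauss ι) := by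
  have hmp := measurePreserving_update i
  have hxf : ExpGrowth fun w => w i * f w := (ExpGrowth.apply i).mul hf
  have hint : ∀ {g : (ι → ℝ) → ℝ}, ExpGrowth g →
      Integrable (fun p : (ι → ℝ) × ℝ => g (Function.update p.1 i p.2))
        ((stdGauss ι).prod (gaussianReal 0 1)) := fun hg =>
    hmp.integrable_comp_of_integrable hg.integrable
  have htr : ∀ {g : (ι → ℝ) → ℝ}, ExpGrowth g → ∫ w, g w ∂(stdGauss ι) =
      ∫ w, ∫ y, g (Function.update w i y) ∂(gaussianReal 0 1) ∂(stdGauss ι) := fun {g} hg => by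
    rw [← integral_prod _ (hint hg)]
    conv_lhs => rw [← hmp.map_eq]
    exact integral_map hmp.aemeasurable hg.continuous.aestronglyMeasurable
  -- With the coordinate `i` resampled, the one-dimensional lemma applies to the inner integral for
  -- almost every `w`.
  rw [htr hxf, htr hf']
  refine integral_congr_ae ?_
  filter_upwards [(hint hf).prod_right_ae, (hint hf').prod_right_ae, (hint hxf).prod_right_ae]
    with w h1 h2 h3
  simp only [Function.update_self] at h3 ⊢
  refine integral_id_mul_gaussianReal (f := fun y => f (Function.update w i y))
      (fun y => ?_) h1 h3 h2
  have h := hd (Function.update w i y)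
  have e : ∀ z, f (Function.update w i z) =
      f (Function.update w i y + (z - y) • Pi.single i (1 : ℝ)) := by
    intro z
    congr 1
    ext j
    by_cases hj : j = i
    · subst hj; simp
    · simp [hj]
  have h' : HasDerivAt (fun s : ℝ => f (Function.update w i y + s • Pi.single i (1 : ℝ)))
      (f' (Function.update w i y)) (y - y) := by rwa [sub_self]
  have := h'.comp_sub_const y y
  refine this.congr_of_eventuallyEq (Filter.Eventually.of_forall fun z => ?_)
  exact e z

end LassoGaussian

/-! ### Exponential moments of Gaussian norms. -/

namespace LassoGaussian

/-- A bound on the means of the exponential tilts of `X` bounds its moment generating function. -/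
theorem mgf_le_of_tilted_mean_le {Ω : Type*} [MeasurableSpace Ω] {μ : Measure Ω}
    [IsProbabilityMeasure μ] {X : Ω → ℝ} {a b l : ℝ} (hl : 0 ≤ l)
    (hint : ∀ t : ℝ, Integrable (fun ω => Real.exp (t * X ω)) μ)
    (h : ∀ t, 0 < t → t < l → ∫ ω, X ω * Real.exp (t * X ω) ∂μ ≤ (a + b * t) * mgf X μ t) :
    mgf X μ l ≤ Real.exp (a * l + b * l ^ 2 / 2) := by
  have huniv : integrableExpSet X μ = Set.univ := Set.eq_univ_of_forall hint
  have hd : ∀ t, HasDerivAt (mgf X μ) (∫ ω, X ω * Real.exp (t * X ω) ∂μ) t := fun t =>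
    hasDerivAt_mgf (by simp [huniv])
  -- `E` is the reciprocal of the claimed bound. The product `mgf * E` equals `1` at `0`, and the
  -- hypothesis on the tilted means says exactly that its derivative is nonpositive.
  set E : ℝ → ℝ := fun t => Real.exp (-(a * t + b * t ^ 2 / 2)) with hE
  have hEd : ∀ t, HasDerivAt E (E t * -(a + b * t)) t := by
    intro t
    have h1 : HasDerivAt (fun t : ℝ => -(a * t + b * t ^ 2 / 2)) (-(a + b * t)) t := by
      have := (((hasDerivAt_id t).const_mul a).add
        (((hasDerivAt_pow 2 t).const_mul b).div_const 2)).neg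
      convert! this using 1
      simp; ring
    exact h1.exp
  have hg : ∀ t, HasDerivAt (fun t => mgf X μ t * E t)
      ((∫ ω, X ω * Real.exp (t * X ω) ∂μ) * E t + mgf X μ t * (E t * -(a + b * t))) t :=
    fun t => (hd t).mul (hEd t)
  have hanti : AntitoneOn (fun t => mgf X μ t * E t) (Set.Icc 0 l) := by
    refine antitoneOn_of_deriv_nonpos (convex_Icc 0 l)
      (fun t _ => (hg t).continuousAt.continuousWithinAt)
      (fun t _ => (hg t).differentiableAt.differentiableWithinAt) fun t ht => ?_
    rw [interior_Icc] at ht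
    rw [(hg t).deriv]
    have h1 := mul_le_mul_of_nonneg_right (h t ht.1 ht.2) (Real.exp_pos _ : 0 < E t).le
    linarith
  have hfin := hanti (Set.left_mem_Icc.2 hl) (Set.right_mem_Icc.2 hl) hl
  have h0 : mgf X μ 0 * E 0 = 1 := by simp [hE]
  simp only [h0] at hfin
  have hEl : E l = (Real.exp (a * l + b * l ^ 2 / 2))⁻¹ := by rw [hE, ← Real.exp_neg]
  rw [hEl, ← div_eq_mul_inv, div_le_one (Real.exp_pos _)] at hfin
  exact hfin

/-- A smooth approximation of the Euclidean norm. -/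
noncomputable def smoothNorm {κ : Type*} [Fintype κ] (ε : ℝ) (x : κ → ℝ) : ℝ :=
  √(ε + ∑ i, x i ^ 2)

section smoothNorm

variable {κ : Type*} [Fintype κ] {ε : ℝ}

theorem sq_smoothNorm (hε : 0 ≤ ε) (x : κ → ℝ) : smoothNorm ε x ^ 2 = ε + ∑ i, x i ^ 2 :=
  Real.sq_sqrt (add_nonneg hε (Finset.sum_nonneg fun _ _ => sq_nonneg _))

theorem sqrt_le_smoothNorm (x : κ → ℝ) : √ε ≤ smoothNorm ε x :=
  Real.sqrt_le_sqrt (le_add_of_nonneg_right (Finset.sum_nonneg fun _ _ => sq_nonneg _))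

theorem smoothNorm_pos (hε : 0 < ε) (x : κ → ℝ) : 0 < smoothNorm ε x :=
  (Real.sqrt_pos.2 hε).trans_le (sqrt_le_smoothNorm x)

theorem smoothNorm_nonneg (x : κ → ℝ) : 0 ≤ smoothNorm ε x := Real.sqrt_nonneg _

theorem sum_sq_le_sq_smoothNorm (hε : 0 ≤ ε) (x : κ → ℝ) :
    ∑ i, x i ^ 2 ≤ smoothNorm ε x ^ 2 := by
  rw [sq_smoothNorm hε]; linarith

theorem abs_apply_le_smoothNorm (hε : 0 ≤ ε) (x : κ → ℝ) (i : κ) : |x i| ≤ smoothNorm ε x := by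
  refine Real.abs_le_sqrt ?_
  have := Finset.single_le_sum (f := fun i => x i ^ 2) (fun _ _ => sq_nonneg _) (Finset.mem_univ i)
  linarith

theorem continuous_smoothNorm : Continuous (smoothNorm ε : (κ → ℝ) → ℝ) := by
  unfold smoothNorm; fun_prop

theorem smoothNorm_le (hε : 0 ≤ ε) (x : κ → ℝ) : smoothNorm ε x ≤ √ε + ∑ i, |x i| := by
  refine Real.sqrt_le_iff.2 ⟨by positivity, ?_⟩
  have h1 : ∑ i, x i ^ 2 ≤ (∑ i, |x i|) ^ 2 := by
    simp only [← sq_abs (x _)]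
    exact Finset.sum_sq_le_sq_sum_of_nonneg fun _ _ => abs_nonneg _
  have h2 : 0 ≤ √ε * ∑ i, |x i| := by positivity
  nlinarith [Real.sq_sqrt hε]

theorem hasDerivAt_smoothNorm (hε : 0 < ε) {x : ℝ → κ → ℝ} {x' : κ → ℝ} {s : ℝ}
    (hx : ∀ i, HasDerivAt (fun τ => x τ i) (x' i) s) :
    HasDerivAt (fun τ => smoothNorm ε (x τ)) ((∑ i, x s i * x' i) / smoothNorm ε (x s)) s := by
  have h1 : HasDerivAt (fun τ => ε + ∑ i, x τ i ^ 2) (∑ i, 2 * (x s i * x' i)) s := by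
    have := HasDerivAt.fun_sum (u := Finset.univ) fun i _ => (hx i).pow 2
    convert! this.const_add ε using 1
    refine Finset.sum_congr rfl fun i _ => ?_
    simp; ring
  have hpos : 0 < ε + ∑ i, x s i ^ 2 := by
    have : 0 ≤ ∑ i, x s i ^ 2 := Finset.sum_nonneg fun _ _ => sq_nonneg _
    linarith
  convert! h1.sqrt hpos.ne' using 1
  rw [← Finset.mul_sum, smoothNorm]
  exact (mul_div_mul_left _ _ two_ne_zero).symm

end smoothNorm

theorem ExpGrowth.exp_mul {ι : Type*} [Fintype ι] {f : (ι → ℝ) → ℝ} (hf : Continuous f) {a c : ℝ}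
    (hc : ∀ w, |f w| ≤ a + c * ∑ i, |w i|) (t : ℝ) : ExpGrowth fun w => Real.exp (t * f w) := by
  refine .of_le (by fun_prop) ((ExpGrowth.const (Real.exp (|t| * a))).mul
    (ExpGrowth.exp_sum_abs (|t| * c))) fun w => ?_
  rw [← Real.exp_add, Real.abs_exp, Real.abs_exp]
  refine Real.exp_le_exp.2 ?_
  calc t * f w ≤ |t| * |f w| := by rw [← abs_mul]; exact le_abs_self _
    _ ≤ |t| * (a + c * ∑ i, |w i|) := mul_le_mul_of_nonneg_left (hc w) (abs_nonneg t)
    _ = _ := by ring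

theorem abs_mulVec_le {m k : Type*} [Fintype m] [Fintype k] (P : Matrix m k ℝ) (w : k → ℝ) :
    ∑ i, |P.mulVec w i| ≤ (∑ i, ∑ j, |P i j|) * ∑ j, |w j| := by
  rw [Finset.sum_mul]
  refine Finset.sum_le_sum fun i _ => (Finset.abs_sum_le_sum_abs _ _).trans ?_
  rw [Finset.sum_mul]
  refine Finset.sum_le_sum fun j _ => ?_
  rw [abs_mul]
  exact mul_le_mul_of_nonneg_left
    (Finset.single_le_sum (f := fun j => |w j|) (fun _ _ => abs_nonneg _) (Finset.mem_univ j))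
    (abs_nonneg _)

variable {κ : Type*} [Fintype κ] {ε : ℝ}

theorem ExpGrowth.exp_mul_smoothNorm (hε : 0 ≤ ε) (t : ℝ) :
    ExpGrowth fun w : κ → ℝ => Real.exp (t * smoothNorm ε w) :=
  .exp_mul continuous_smoothNorm (a := √ε) (c := 1) (fun w => by
    rw [abs_of_nonneg (smoothNorm_nonneg w), one_mul]; exact smoothNorm_le hε w) t

theorem ExpGrowth.exp_mul_smoothNorm_mulVec (hε : 0 ≤ ε) (P : Matrix κ κ ℝ) (t : ℝ) :
    ExpGrowth fun w : κ → ℝ => Real.exp (t * smoothNorm ε (P.mulVec w)) :=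
  .exp_mul (f := fun w => LassoGaussian.smoothNorm ε (P.mulVec w))
    (continuous_smoothNorm.comp (by fun_prop)) (a := √ε) (c := ∑ i, ∑ j, |P i j|)
    (fun w => by
      rw [abs_of_nonneg (smoothNorm_nonneg _)]
      exact (smoothNorm_le hε _).trans (add_le_add le_rfl (abs_mulVec_le P w))) t

theorem ExpGrowth.smoothNorm (hε : 0 ≤ ε) :
    ExpGrowth fun w : κ → ℝ => smoothNorm ε w :=
  .of_le continuous_smoothNorm ((ExpGrowth.const (√ε)).add .sum_abs) fun w => by
    rw [abs_of_nonneg (smoothNorm_nonneg w)]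
    exact (smoothNorm_le hε w).trans (le_abs_self _)

theorem ExpGrowth.inv_smoothNorm (hε : 0 < ε) :
    ExpGrowth fun w : κ → ℝ => (LassoGaussian.smoothNorm ε w)⁻¹ := by
  refine .of_le (continuous_smoothNorm.inv₀ fun w => (smoothNorm_pos hε w).ne')
    (ExpGrowth.const (√ε)⁻¹) fun w => ?_
  have := Real.sqrt_pos.2 hε
  rw [abs_of_pos (inv_pos.2 (smoothNorm_pos hε w)), abs_of_pos (inv_pos.2 this)]
  exact inv_anti₀ this (sqrt_le_smoothNorm w)

theorem hasDerivAt_add_smul_single {κ : Type*} [DecidableEq κ] (w : κ → ℝ) (i j : κ) :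
    HasDerivAt (fun s : ℝ => (w + s • (Pi.single i 1 : κ → ℝ)) j)
        ((Pi.single i 1 : κ → ℝ) j) 0 := by
  have := ((hasDerivAt_id (0 : ℝ)).mul_const ((Pi.single i 1 : κ → ℝ) j)).const_add (w j)
  simpa using this

variable [DecidableEq κ]

/-- Exponential lower-tail bound for the norm of a standard Gaussian vector. -/
theorem mgf_neg_smoothNorm_le (hε : 0 < ε) {l : ℝ} (hl : 0 ≤ l) (hκ : 1 ≤ Fintype.card κ) :
    ∫ w : κ → ℝ, Real.exp (-l * smoothNorm ε w) ∂(stdGauss κ) ≤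
      Real.exp (-l * √((Fintype.card κ : ℝ) - 1) + l ^ 2 / 4) := by
  set n : ℝ := (Fintype.card κ : ℝ) with hn
  have hn1 : 0 ≤ n - 1 := by
    have : (1 : ℝ) ≤ n := Nat.one_le_cast.2 hκ
    linarith
  set N : (κ → ℝ) → ℝ := smoothNorm ε with hN
  have hNpos : ∀ w, 0 < N w := smoothNorm_pos hε
  have hG : ∀ t, ExpGrowth fun w => Real.exp (t * N w) := fun t =>
    ExpGrowth.exp_mul_smoothNorm hε.le t
  have hGN : ExpGrowth N := ExpGrowth.smoothNorm hε.le
  have hGi : ExpGrowth fun w => (N w)⁻¹ := ExpGrowth.inv_smoothNorm hε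
  -- Stein's identity for the vector field `w N⁻¹ exp (-t N)`, whose divergence is at least `((n -
  -- 1) / N - t) exp (-t N)`. Hence the tilted mean `q` of `N` satisfies `q ≥ (n - 1) / q - t`, that
  -- is `q ≥ √(n - 1) - t / 2`. The slope `1 / 2` in `t` integrates to `l ^ 2 / 4`.
  have key : mgf (fun w => -N w) (stdGauss κ) l ≤
      Real.exp (-√(n - 1) * l + (1 / 2) * l ^ 2 / 2) := by
    refine mgf_le_of_tilted_mean_le hl (fun t => ?_) fun t ht _ => ?_
    · simpa using (hG (-t)).integrable
    set e : (κ → ℝ) → ℝ := fun w => Real.exp (-t * N w) with he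
    have hepos : ∀ w, 0 < e w := fun w => Real.exp_pos _
    have hGe : ExpGrowth e := hG (-t)
    set f : κ → (κ → ℝ) → ℝ := fun i w => w i * (N w)⁻¹ * e w with hf
    set f' : κ → (κ → ℝ) → ℝ := fun i w =>
      ((N w)⁻¹ + (-1) * (w i * w i) * ((N w)⁻¹ * (N w)⁻¹ * (N w)⁻¹)
        + (-t) * (w i * w i) * ((N w)⁻¹ * (N w)⁻¹)) * e w with hf'
    have hfG : ∀ i, ExpGrowth (f i) := fun i => ((ExpGrowth.apply i).mul hGi).mul hGe
    have hfG' : ∀ i, ExpGrowth (f' i) := fun i =>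
      ((hGi.add (((ExpGrowth.const (-1)).mul ((ExpGrowth.apply i).mul (.apply i))).mul
        ((hGi.mul hGi).mul hGi))).add
        (((ExpGrowth.const (-t)).mul ((ExpGrowth.apply i).mul (.apply i))).mul
        (hGi.mul hGi))).mul hGe
    have hder : ∀ i w, HasDerivAt (fun s : ℝ => f i (w + s • Pi.single i 1)) (f' i w) 0 := by
      intro i w
      have h0 := hasDerivAt_smoothNorm hε (x := fun s => w + s • Pi.single i (1 : ℝ))
        (fun j => hasDerivAt_add_smul_single w i j)
      have hsum : ∑ j, (w + (0 : ℝ) • (Pi.single i 1 : κ → ℝ)) j * (Pi.single i 1 : κ → ℝ) j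
          = w i := by
        simp [Pi.single_apply]
      rw [hsum] at h0
      have h1 := (((hasDerivAt_add_smul_single w i i).mul (h0.inv (by
        simpa using (hNpos w).ne'))).mul ((h0.const_mul (-t)).exp))
      convert! h1 using 1
      simp only [Pi.mul_apply, Pi.inv_apply, zero_smul, add_zero, Pi.single_eq_same, hf']
      simp only [he, hN]
      have := (smoothNorm_pos hε w).ne'
      field_simp
    have hstein : ∑ i, ∫ w, w i * f i w ∂(stdGauss κ) = ∑ i, ∫ w, f' i w ∂(stdGauss κ) :=
      Finset.sum_congr rfl fun i _ => integral_apply_mul_stdGauss i (hfG i) (hfG' i) (hder i)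
    rw [← integral_finsetSum _ fun i _ => ((ExpGrowth.apply i).mul (hfG i)).integrable,
      ← integral_finsetSum _ fun i _ => (hfG' i).integrable] at hstein
    have hNe : Integrable (fun w => N w * e w) (stdGauss κ) := (hGN.mul hGe).integrable
    have hie : Integrable (fun w => (N w)⁻¹ * e w) (stdGauss κ) := (hGi.mul hGe).integrable
    have hup : ∫ w, ∑ i, w i * f i w ∂(stdGauss κ) ≤ ∫ w, N w * e w ∂(stdGauss κ) := by
      refine integral_mono (integrable_finsetSum _
        fun i _ => ((ExpGrowth.apply i).mul (hfG i)).integrable) hNe fun w => ?_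
      have : ∑ i, w i * f i w = (∑ i, w i ^ 2) * ((N w)⁻¹ * e w) := by
        rw [Finset.sum_mul]; exact Finset.sum_congr rfl fun i _ => by rw [hf]; ring
      simp only [this]
      calc (∑ i, w i ^ 2) * ((N w)⁻¹ * e w) ≤ N w ^ 2 * ((N w)⁻¹ * e w) :=
            mul_le_mul_of_nonneg_right (sum_sq_le_sq_smoothNorm hε.le w)
              (mul_nonneg (inv_nonneg.2 (hNpos w).le) (hepos w).le)
        _ = N w * e w := by
            have := (hNpos w).ne'
            field_simp
    have hlow : (n - 1) * ∫ w, (N w)⁻¹ * e w ∂(stdGauss κ) - t * ∫ w, e w ∂(stdGauss κ) ≤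
        ∫ w, ∑ i, f' i w ∂(stdGauss κ) := by
      rw [← integral_const_mul, ← integral_const_mul,
        ← integral_sub (hie.const_mul _) (hGe.integrable.const_mul _)]
      refine integral_mono ((hie.const_mul _).sub (hGe.integrable.const_mul _))
        (integrable_finsetSum _ fun i _ => (hfG' i).integrable) fun w => ?_
      have h1 : ∑ i, f' i w = (n * (N w)⁻¹ - (∑ i, w i ^ 2) * (N w)⁻¹ ^ 3
          - t * (∑ i, w i ^ 2) * (N w)⁻¹ ^ 2) * e w := by
        simp only [hf', ← Finset.sum_mul, Finset.sum_add_distrib, ← Finset.mul_sum]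
        simp only [Finset.sum_const, Finset.card_univ, nsmul_eq_mul, ← hn, pow_two]
        ring
      simp only [h1]
      have hr := sum_sq_le_sq_smoothNorm hε.le w
      have hi : 0 < (N w)⁻¹ := inv_pos.2 (hNpos w)
      have h2 : (∑ i, w i ^ 2) * (N w)⁻¹ ^ 2 ≤ 1 := by
        rw [inv_pow, ← div_eq_mul_inv]
        exact div_le_one_of_le₀ hr (sq_nonneg _)
      have h3 : (∑ i, w i ^ 2) * (N w)⁻¹ ^ 3 ≤ (N w)⁻¹ := by
        have := mul_le_mul_of_nonneg_right h2 hi.le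
        linarith
      have h4 : t * (∑ i, w i ^ 2) * (N w)⁻¹ ^ 2 ≤ t := by
        have := mul_le_mul_of_nonneg_left h2 ht.le
        linarith
      have : ((n - 1) * (N w)⁻¹ - t) * e w ≤ (n * (N w)⁻¹ - (∑ i, w i ^ 2) * (N w)⁻¹ ^ 3
          - t * (∑ i, w i ^ 2) * (N w)⁻¹ ^ 2) * e w :=
        mul_le_mul_of_nonneg_right (by linarith) (hepos w).le
      linarith
    set Mt := ∫ w, e w ∂(stdGauss κ) with hMt
    set A := ∫ w, N w * e w ∂(stdGauss κ) with hA
    set B := ∫ w, (N w)⁻¹ * e w ∂(stdGauss κ) with hB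
    have hMpos : 0 < Mt := integral_exp_pos hGe.integrable
    have hApos : 0 < A := by
      have : √ε * Mt ≤ A := by
        rw [hMt, ← integral_const_mul]
        exact integral_mono (hGe.integrable.const_mul _) hNe fun w =>
          mul_le_mul_of_nonneg_right (sqrt_le_smoothNorm w) (hepos w).le
      exact (mul_pos (Real.sqrt_pos.2 hε) hMpos).trans_le this
    set q := A / Mt with hq
    have hqpos : 0 < q := div_pos hApos hMpos
    have hAq : A = q * Mt := by rw [hq, div_mul_cancel₀ _ hMpos.ne']
    have hBq : Mt ≤ q * B := by
      have h5 : 2 * Mt - q⁻¹ * A ≤ q * B := by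
        rw [hMt, hA, hB, ← integral_const_mul, ← integral_const_mul, ← integral_const_mul,
          ← integral_sub (hGe.integrable.const_mul _) (hNe.const_mul _)]
        refine integral_mono ((hGe.integrable.const_mul _).sub (hNe.const_mul _))
          (hie.const_mul _) fun w => ?_
        -- The tangent line of `x ↦ 1 / x` at `q`; integrated, it is Jensen's inequality `E[1 / N] ≥
        -- 1 / q` for the tilted law.
        have h6 : 2 - q⁻¹ * N w ≤ q * (N w)⁻¹ := by
          have hp := hNpos w
          rw [← sub_nonneg]
          have : q * (N w)⁻¹ - (2 - q⁻¹ * N w) = (q - N w) ^ 2 / (q * N w) := by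
            field_simp; ring
          rw [this]; positivity
        have := mul_le_mul_of_nonneg_right h6 (hepos w).le
        simp only
        linarith
      rw [hAq, ← mul_assoc, inv_mul_cancel₀ hqpos.ne', one_mul] at h5
      linarith
    have hq2 : n - 1 ≤ q ^ 2 + t * q := by
      have h7 : (n - 1) * B - t * Mt ≤ q * Mt := by linarith
      have h8 : (n - 1) * Mt ≤ (n - 1) * (q * B) := mul_le_mul_of_nonneg_left hBq hn1
      have h9 : (n - 1) * Mt ≤ (q ^ 2 + t * q) * Mt := by nlinarith
      exact le_of_mul_le_mul_right h9 hMpos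
    have hfin : √(n - 1) ≤ q + t / 2 := by
      rw [Real.sqrt_le_iff]
      exact ⟨by positivity, by nlinarith⟩
    have hl' : ∫ w, -N w * Real.exp (t * -N w) ∂(stdGauss κ) = -A := by
      rw [hA, ← integral_neg]
      refine integral_congr_ae (Filter.Eventually.of_forall fun w => ?_)
      simp [he]
    have hm' : mgf (fun w => -N w) (stdGauss κ) t = Mt := by
      simp [mgf, hMt, he]
    rw [hl', hm', hAq]
    nlinarith
  have e1 : mgf (fun w => -N w) (stdGauss κ) l =
      ∫ w : κ → ℝ, Real.exp (-l * smoothNorm ε w) ∂(stdGauss κ) := by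
    simp [mgf, hN]
  rw [e1] at key
  convert key using 2
  ring

/-- Exponential upper-tail bound for the norm of a projection of a standard Gaussian vector. -/
theorem mgf_smoothNorm_mulVec_le (hε : 0 < ε) {l : ℝ} (hl : 0 ≤ l) {P : Matrix κ κ ℝ}
    (hP : P.transpose = P) (hPP : P * P = P) {k : ℝ} (hk : P.trace ≤ k) (hk0 : 0 ≤ k) :
    ∫ w : κ → ℝ, Real.exp (l * smoothNorm ε (P.mulVec w)) ∂(stdGauss κ) ≤
      Real.exp (l * √(k + ε) + l ^ 2 / 2) := by
  set N : (κ → ℝ) → ℝ := fun w => smoothNorm ε (P.mulVec w) with hN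
  have hcont : Continuous fun w : κ → ℝ => P.mulVec w := by fun_prop
  have hNpos : ∀ w, 0 < N w := fun w => smoothNorm_pos hε _
  have hG : ∀ t, ExpGrowth fun w => Real.exp (t * N w) := fun t =>
    ExpGrowth.exp_mul_smoothNorm_mulVec hε.le P t
  have hGy : ∀ i, ExpGrowth fun w => P.mulVec w i := fun i =>
    ExpGrowth.sum _ fun j _ => (ExpGrowth.const (P i j)).mul (.apply j)
  have hGN : ExpGrowth N := by
    refine .of_le (continuous_smoothNorm.comp hcont) (hG 1) fun w => ?_
    rw [abs_of_pos (hNpos w), Real.abs_exp, one_mul]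
    linarith [Real.add_one_le_exp (N w)]
  have hGi : ExpGrowth fun w => (N w)⁻¹ := by
    have := Real.sqrt_pos.2 hε
    refine .of_le (hGN.continuous.inv₀ fun w => (hNpos w).ne') (ExpGrowth.const (√ε)⁻¹) fun w => ?_
    rw [abs_of_pos (inv_pos.2 (hNpos w)), abs_of_pos (inv_pos.2 this)]
    exact inv_anti₀ this (sqrt_le_smoothNorm _)
  have hPy : ∀ w, P.mulVec (P.mulVec w) = P.mulVec w := fun w => by
    rw [Matrix.mulVec_mulVec, hPP]
  have hsym : ∀ i j, P i j = P j i := fun i j => congrFun (congrFun hP.symm i) j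
  have hdot : ∀ w, ∑ i, w i * P.mulVec w i = ∑ i, P.mulVec w i ^ 2 := fun w => by
    have h1 : w ⬝ᵥ P.mulVec w = P.mulVec w ⬝ᵥ P.mulVec w := by
      conv_lhs => rw [← hPP, ← Matrix.mulVec_mulVec, Matrix.dotProduct_mulVec,
        ← Matrix.mulVec_transpose, hP]
    simpa [dotProduct, pow_two] using h1
  -- Stein's identity for the field `P w exp (t N)`, whose divergence is `(tr P + t ‖P w‖² / N) exp
  -- (t N)`. The tilted mean `q` of `N` then satisfies `q ^ 2 ≤ k + ε + t q`, hence `q ≤ √(k + ε) +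
  -- t`.
  have key : mgf N (stdGauss κ) l ≤ Real.exp (√(k + ε) * l + 1 * l ^ 2 / 2) := by
    refine mgf_le_of_tilted_mean_le hl (fun t => (hG t).integrable) fun t ht _ => ?_
    set e : (κ → ℝ) → ℝ := fun w => Real.exp (t * N w) with he
    have hepos : ∀ w, 0 < e w := fun w => Real.exp_pos _
    have hGe : ExpGrowth e := hG t
    set f : κ → (κ → ℝ) → ℝ := fun i w => P.mulVec w i * e w with hf
    set f' : κ → (κ → ℝ) → ℝ := fun i w =>
      (P i i + t * (P.mulVec w i * P.mulVec w i) * (N w)⁻¹) * e w with hf'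
    have hfG : ∀ i, ExpGrowth (f i) := fun i => (hGy i).mul hGe
    have hfG' : ∀ i, ExpGrowth (f' i) := fun i =>
      ((ExpGrowth.const _).add (((ExpGrowth.const t).mul ((hGy i).mul (hGy i))).mul hGi)).mul hGe
    have hder : ∀ i w, HasDerivAt (fun s : ℝ => f i (w + s • Pi.single i 1)) (f' i w) 0 := by
      intro i w
      have hy : ∀ j,
          HasDerivAt (fun s : ℝ => P.mulVec (w + s • (Pi.single i 1 : κ → ℝ)) j) (P j i) 0 := by
        intro j
        have := ((hasDerivAt_id (0 : ℝ)).mul_const (P j i)).const_add (P.mulVec w j)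
        simp only [Matrix.mulVec_add, Matrix.mulVec_smul, Matrix.mulVec_single_one]
        simpa using this
      have h0 := hasDerivAt_smoothNorm hε (x := fun s => P.mulVec (w + s • Pi.single i (1 : ℝ))) hy
      have hsum : ∑ j, P.mulVec (w + (0 : ℝ) • (Pi.single i 1 : κ → ℝ)) j * P j i
          = P.mulVec w i := by
        conv_rhs => rw [← hPy w]
        simp only [zero_smul, add_zero]
        rw [Matrix.mulVec, dotProduct]
        exact Finset.sum_congr rfl fun j _ => by rw [hsym i j, mul_comm]
      rw [hsum] at h0
      have h1 := (hy i).mul ((h0.const_mul t).exp)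
      convert! h1 using 1
      simp only [zero_smul, add_zero, hf']
      simp only [he, hN]
      have := (hNpos w).ne'
      ring
    have hstein : ∑ i, ∫ w, w i * f i w ∂(stdGauss κ) = ∑ i, ∫ w, f' i w ∂(stdGauss κ) :=
      Finset.sum_congr rfl fun i _ => integral_apply_mul_stdGauss i (hfG i) (hfG' i) (hder i)
    rw [← integral_finsetSum _ fun i _ => ((ExpGrowth.apply i).mul (hfG i)).integrable,
      ← integral_finsetSum _ fun i _ => (hfG' i).integrable] at hstein
    have hNe : Integrable (fun w => N w * e w) (stdGauss κ) := (hGN.mul hGe).integrable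
    have hNNe : Integrable (fun w => N w * N w * e w) (stdGauss κ) :=
      ((hGN.mul hGN).mul hGe).integrable
    have hlow : ∫ w, N w * N w * e w ∂(stdGauss κ) - ε * ∫ w, e w ∂(stdGauss κ) =
        ∫ w, ∑ i, w i * f i w ∂(stdGauss κ) := by
      rw [← integral_const_mul, ← integral_sub hNNe (hGe.integrable.const_mul _)]
      refine integral_congr_ae (Filter.Eventually.of_forall fun w => ?_)
      have : ∑ i, w i * f i w = (∑ i, P.mulVec w i ^ 2) * e w := by
        rw [← hdot, Finset.sum_mul]
        exact Finset.sum_congr rfl fun i _ => by rw [hf]; ring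
      simp only [this]
      have := sq_smoothNorm hε.le (P.mulVec w)
      have h2 : N w * N w = ε + ∑ i, P.mulVec w i ^ 2 := by rw [← this, pow_two]
      rw [h2]; ring
    have hup : ∫ w, ∑ i, f' i w ∂(stdGauss κ) ≤
        k * ∫ w, e w ∂(stdGauss κ) + t * ∫ w, N w * e w ∂(stdGauss κ) := by
      rw [← integral_const_mul, ← integral_const_mul,
        ← integral_add (hGe.integrable.const_mul _) (hNe.const_mul _)]
      refine integral_mono (integrable_finsetSum _ fun i _ => (hfG' i).integrable)
        ((hGe.integrable.const_mul _).add (hNe.const_mul _)) fun w => ?_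
      have h1 : ∑ i, f' i w = (P.trace + t * (∑ i, P.mulVec w i ^ 2) * (N w)⁻¹) * e w := by
        simp only [hf', ← Finset.sum_mul, Finset.sum_add_distrib, ← Finset.mul_sum, pow_two,
          Matrix.trace, Matrix.diag_apply]
      simp only [h1]
      have h2 : (∑ i, P.mulVec w i ^ 2) * (N w)⁻¹ ≤ N w := by
        rw [← div_eq_mul_inv, div_le_iff₀ (hNpos w), ← pow_two]
        exact sum_sq_le_sq_smoothNorm hε.le _
      have h3 : t * (∑ i, P.mulVec w i ^ 2) * (N w)⁻¹ ≤ t * N w := by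
        rw [mul_assoc]; exact mul_le_mul_of_nonneg_left h2 ht.le
      have := mul_le_mul_of_nonneg_right (add_le_add hk h3) (hepos w).le
      linarith
    set Mt := ∫ w, e w ∂(stdGauss κ) with hMt
    set A := ∫ w, N w * e w ∂(stdGauss κ) with hA
    set B := ∫ w, N w * N w * e w ∂(stdGauss κ) with hB
    have hMpos : 0 < Mt := integral_exp_pos hGe.integrable
    set q := A / Mt with hq
    have hAq : A = q * Mt := by rw [hq, div_mul_cancel₀ _ hMpos.ne']
    have hBq : q ^ 2 * Mt ≤ B := by
      -- Nonnegativity of the integral of `(N - q) ^ 2` against the tilt: the second moment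
      -- dominates the squared mean.
      have h5 : 2 * q * A - q ^ 2 * Mt ≤ B := by
        rw [hMt, hA, hB, ← integral_const_mul, ← integral_const_mul,
          ← integral_sub (hNe.const_mul _) (hGe.integrable.const_mul _)]
        refine integral_mono ((hNe.const_mul _).sub (hGe.integrable.const_mul _)) hNNe fun w => ?_
        have := mul_nonneg (sq_nonneg (N w - q)) (hepos w).le
        simp only
        linarith
      rw [hAq] at h5
      linarith
    have hq2 : q ^ 2 ≤ k + ε + t * q := by
      have h9 : q ^ 2 * Mt ≤ (k + ε + t * q) * Mt := by nlinarith
      exact le_of_mul_le_mul_right h9 hMpos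
    have hfin : q ≤ √(k + ε) + t := by
      by_contra! hlt
      have hs := Real.sqrt_nonneg (k + ε)
      have hss := Real.sq_sqrt (show 0 ≤ k + ε by linarith)
      nlinarith
    have hm' : mgf N (stdGauss κ) t = Mt := rfl
    rw [hm']
    change A ≤ _
    rw [hAq, one_mul]
    exact mul_le_mul_of_nonneg_right hfin hMpos.le
  rw [mul_comm l, ← one_mul (l ^ 2)]
  exact key

end LassoGaussian

/-! ### Gaussian interpolation between two linear images. -/

namespace LassoGaussian

theorem ExpGrowth.of_le_exp_mul {ι : Type*} [Fintype ι] {f : (ι → ℝ) → ℝ} (hf : Continuous f)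
    {C K c : ℝ}
    (h : ∀ w, |f w| ≤ C * Real.exp (c * (K * ∑ i, |w i|)) * (1 + ∑ i, |w i|)) :
    ExpGrowth f := by
  refine .of_le hf (((ExpGrowth.const C).mul (.exp_sum_abs (c * K))).mul
    ((ExpGrowth.const 1).add .sum_abs)) fun w => (h w).trans ?_
  rw [← mul_assoc]
  exact le_abs_self _

/-- Gaussian interpolation: a comparison of the expectations of a smooth function of two linear
images of a standard Gaussian vector. -/
theorem integral_comp_le_of_sum_fderiv_le {ι : Type*} [Fintype ι] [DecidableEq ι]
    {E : Type*} [NormedAddCommGroup E] [NormedSpace ℝ E] {f : E → ℝ} (hf : ContDiff ℝ 2 f)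
    (A B : (ι → ℝ) →L[ℝ] E) {C c : ℝ} (hC : 0 ≤ C) (hc : 0 ≤ c)
    (h0 : ∀ z, |f z| ≤ C * Real.exp (c * ‖z‖))
    (h1 : ∀ z ξ, |fderiv ℝ f z ξ| ≤ C * Real.exp (c * ‖z‖) * ‖ξ‖)
    (h2 : ∀ z ξ η, |fderiv ℝ (fderiv ℝ f) z ξ η| ≤ C * Real.exp (c * ‖z‖) * ‖ξ‖ * ‖η‖)
    (hAB : ∀ i, A (Pi.single i 1) = 0 ∨ B (Pi.single i 1) = 0)
    (hle : ∀ z, ∑ i, fderiv ℝ (fderiv ℝ f) z (A (Pi.single i 1)) (A (Pi.single i 1)) ≤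
      ∑ i, fderiv ℝ (fderiv ℝ f) z (B (Pi.single i 1)) (B (Pi.single i 1))) :
    ∫ w, f (A w) ∂(stdGauss ι) ≤ ∫ w, f (B w) ∂(stdGauss ι) := by
  set K : ℝ := ‖A‖ + ‖B‖ with hK
  have hK0 : 0 ≤ K := by positivity
  have hs : ∀ w : ι → ℝ, 0 ≤ ∑ i, |w i| := fun w => Finset.sum_nonneg fun _ _ => abs_nonneg _
  have hsup : ∀ w : ι → ℝ, ‖w‖ ≤ ∑ i, |w i| := fun w =>
    (pi_norm_le_iff_of_nonneg (hs w)).2 fun i =>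
      Finset.single_le_sum (f := fun i => |w i|) (fun _ _ => abs_nonneg _) (Finset.mem_univ i)
  have hcomb : ∀ (a b : ℝ) (w : ι → ℝ), |a| ≤ 1 → |b| ≤ 1 → ‖a • A w + b • B w‖ ≤ K * ‖w‖ := by
    intro a b w ha hb
    calc ‖a • A w + b • B w‖ ≤ |a| * ‖A w‖ + |b| * ‖B w‖ := by
          refine (norm_add_le _ _).trans ?_
          rw [norm_smul, norm_smul, Real.norm_eq_abs, Real.norm_eq_abs]
      _ ≤ 1 * (‖A‖ * ‖w‖) + 1 * (‖B‖ * ‖w‖) := by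
          gcongr
          · exact A.le_opNorm w
          · exact B.le_opNorm w
      _ = _ := by rw [hK]; ring
  have hcomb' : ∀ (a b : ℝ) (w : ι → ℝ), |a| ≤ 1 → |b| ≤ 1 →
      ‖a • A w + b • B w‖ ≤ K * ∑ i, |w i| := fun a b w ha hb =>
    (hcomb a b w ha hb).trans (mul_le_mul_of_nonneg_left (hsup w) hK0)
  -- A rotation from `B w` at `θ = 0` to `A w` at `θ = π / 2`, with velocity `Z'`. The expectation
  -- of `f (Z θ w)` will be shown to decrease in `θ`.
  set Z : ℝ → (ι → ℝ) → E := fun θ w => Real.sin θ • A w + Real.cos θ • B w with hZ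
  set Z' : ℝ → (ι → ℝ) → E := fun θ w => Real.cos θ • A w + (-Real.sin θ) • B w with hZ'
  have hZn : ∀ θ w, ‖Z θ w‖ ≤ K * ∑ i, |w i| := fun θ w =>
    hcomb' _ _ w (Real.abs_sin_le_one θ) (Real.abs_cos_le_one θ)
  have hsin : ∀ θ, |(-Real.sin θ)| ≤ 1 := fun θ => by
    rw [abs_neg]; exact Real.abs_sin_le_one θ
  have hZn' : ∀ θ w, ‖Z' θ w‖ ≤ K * ∑ i, |w i| := fun θ w =>
    hcomb' _ _ w (Real.abs_cos_le_one θ) (hsin θ)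
  have hexp : ∀ θ w, Real.exp (c * ‖Z θ w‖) ≤ Real.exp (c * (K * ∑ i, |w i|)) := fun θ w =>
    Real.exp_le_exp.2 (mul_le_mul_of_nonneg_left (hZn θ w) hc)
  have hZc : ∀ θ, Continuous (Z θ) := fun θ => by rw [hZ]; fun_prop
  have hZc' : ∀ θ, Continuous (Z' θ) := fun θ => by rw [hZ']; fun_prop
  have hf0 : Continuous f := hf.continuous
  have hf1 : ContDiff ℝ 1 (fderiv ℝ f) := hf.fderiv_right (by norm_num)
  have hf1c : Continuous (fderiv ℝ f) := hf1.continuous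
  have hf2c : Continuous (fderiv ℝ (fderiv ℝ f)) := hf1.continuous_fderiv (by norm_num)
  have hfd : ∀ z, HasFDerivAt f (fderiv ℝ f z) z := fun z =>
    (hf.differentiable (by norm_num) z).hasFDerivAt
  have hfd1 : ∀ z, HasFDerivAt (fderiv ℝ f) (fderiv ℝ (fderiv ℝ f) z) z := fun z =>
    (hf1.differentiable (by norm_num) z).hasFDerivAt
  have hG0 : ∀ θ, ExpGrowth fun w => f (Z θ w) := fun θ =>
    .of_le_exp_mul (hf0.comp (hZc θ)) (C := C) (K := K) (c := c) fun w => by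
      refine (h0 _).trans ((mul_le_mul_of_nonneg_left (hexp θ w) hC).trans ?_)
      exact le_mul_of_one_le_right (by positivity) (by linarith [hs w])
  have hG1 : ∀ θ ξ, ExpGrowth fun w => fderiv ℝ f (Z θ w) ξ := fun θ ξ =>
    .of_le_exp_mul ((hf1c.comp (hZc θ)).clm_apply continuous_const) (C := C * ‖ξ‖) (K := K) (c := c)
      fun w => by
      refine (h1 _ ξ).trans ?_
      calc C * Real.exp (c * ‖Z θ w‖) * ‖ξ‖ ≤ C * Real.exp (c * (K * ∑ i, |w i|)) * ‖ξ‖ := by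
            gcongr C * ?_ * _; exact hexp θ w
        _ = C * ‖ξ‖ * Real.exp (c * (K * ∑ i, |w i|)) := by ring
        _ ≤ _ := le_mul_of_one_le_right (by positivity) (by linarith [hs w])
  have hG2 : ∀ θ ξ η, ExpGrowth fun w => fderiv ℝ (fderiv ℝ f) (Z θ w) ξ η := fun θ ξ η =>
    .of_le_exp_mul (((hf2c.comp (hZc θ)).clm_apply continuous_const).clm_apply continuous_const)
      (C := C * ‖ξ‖ * ‖η‖) (K := K) (c := c) fun w => by
      refine (h2 _ ξ η).trans ?_
      calc C * Real.exp (c * ‖Z θ w‖) * ‖ξ‖ * ‖η‖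
            ≤ C * Real.exp (c * (K * ∑ i, |w i|)) * ‖ξ‖ * ‖η‖ := by
            gcongr C * ?_ * _ * _; exact hexp θ w
        _ = C * ‖ξ‖ * ‖η‖ * Real.exp (c * (K * ∑ i, |w i|)) := by ring
        _ ≤ _ := le_mul_of_one_le_right (by positivity) (by linarith [hs w])
  have hcurve : ∀ w θ, HasDerivAt (fun θ => Z θ w) (Z' θ w) θ := fun w θ =>
    ((Real.hasDerivAt_sin θ).smul_const (A w)).add ((Real.hasDerivAt_cos θ).smul_const (B w))
  have hF : ∀ θ, HasDerivAt (fun θ => ∫ w, f (Z θ w) ∂(stdGauss ι))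
      (∫ w, fderiv ℝ f (Z θ w) (Z' θ w) ∂(stdGauss ι)) θ := by
    intro θ
    refine (hasDerivAt_integral_of_dominated_loc_of_deriv_le (s := Set.univ)
      (F' := fun θ w => fderiv ℝ f (Z θ w) (Z' θ w))
      (bound := fun w => C * Real.exp (c * K * ∑ i, |w i|) * (K * ∑ i, |w i|)) Filter.univ_mem
      (Filter.Eventually.of_forall fun θ => (hG0 θ).continuous.aestronglyMeasurable)
      (hG0 θ).integrable ((hf1c.comp (hZc θ)).clm_apply (hZc' θ)).aestronglyMeasurable
      (Filter.Eventually.of_forall fun w θ _ => ?_)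
      (((ExpGrowth.const C).mul (.exp_sum_abs (c * K))).mul
        ((ExpGrowth.const K).mul .sum_abs)).integrable
      (Filter.Eventually.of_forall fun w θ _ => ?_)).2
    · rw [Real.norm_eq_abs, mul_assoc c K]
      refine (h1 _ _).trans ?_
      gcongr
      · exact hZn θ w
      · exact hZn' θ w
    · exact (hfd (Z θ w)).comp_hasDerivAt θ (hcurve w θ)
  have hsumA : ∀ w : ι → ℝ, w = ∑ i, w i • (Pi.single i 1 : ι → ℝ) := fun w => by
    ext j; simp [Finset.sum_apply, Pi.single_apply]
  have hderiv : ∀ θ, ∫ w, fderiv ℝ f (Z θ w) (Z' θ w) ∂(stdGauss ι) =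
      Real.sin θ * Real.cos θ * ∫ w,
        (∑ i, fderiv ℝ (fderiv ℝ f) (Z θ w) (A (Pi.single i 1)) (A (Pi.single i 1)) -
          ∑ i, fderiv ℝ (fderiv ℝ f) (Z θ w) (B (Pi.single i 1)) (B (Pi.single i 1)))
        ∂(stdGauss ι) := by
    intro θ
    have e1 : ∀ w, fderiv ℝ f (Z θ w) (Z' θ w) =
        ∑ i, w i * fderiv ℝ f (Z θ w) (Z' θ (Pi.single i 1)) := by
      intro w
      have : Z' θ w = ∑ i, w i • Z' θ (Pi.single i 1) := by
        have hlin : ∀ u, Z' θ u = (Real.cos θ • A + (-Real.sin θ) • B) u := fun u => rfl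
        rw [hlin w]
        conv_lhs => rw [hsumA w]
        rw [map_sum]
        exact Finset.sum_congr rfl fun i _ => by rw [map_smul, hlin]
      rw [this, map_sum]
      exact Finset.sum_congr rfl fun i _ => by rw [map_smul, smul_eq_mul]
    simp only [e1]
    rw [integral_finsetSum _ fun i _ => ((ExpGrowth.apply i).mul (hG1 θ _)).integrable,
      ← integral_const_mul]
    -- Stein's lemma trades the factor `w i` for a second derivative in the direction `Z θ
    -- (Pi.single i 1)`.
    have e2 : ∀ i, ∫ w, w i * fderiv ℝ f (Z θ w) (Z' θ (Pi.single i 1)) ∂(stdGauss ι) =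
        ∫ w, fderiv ℝ (fderiv ℝ f) (Z θ w) (Z θ (Pi.single i 1)) (Z' θ (Pi.single i 1))
          ∂(stdGauss ι) := by
      intro i
      refine integral_apply_mul_stdGauss i (hG1 θ _) (hG2 θ _ _) fun w => ?_
      have hl : HasDerivAt (fun s : ℝ => Z θ (w + s • (Pi.single i 1 : ι → ℝ)))
          (Z θ (Pi.single i 1)) 0 := by
        have hlin : ∀ u, Z θ u = (Real.sin θ • A + Real.cos θ • B) u := fun u => rfl
        simp only [hlin, map_add, map_smul]
        have := ((hasDerivAt_id (0 : ℝ)).smul_const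
          ((Real.sin θ • A + Real.cos θ • B) (Pi.single i 1))).const_add
            ((Real.sin θ • A + Real.cos θ • B) w)
        simpa using this
      have hz : Z θ (w + (0 : ℝ) • (Pi.single i 1 : ι → ℝ)) = Z θ w := by simp
      have h3 := (hz ▸ hfd1 (Z θ w) :
        HasFDerivAt (fderiv ℝ f) (fderiv ℝ (fderiv ℝ f) (Z θ w))
          (Z θ (w + (0 : ℝ) • (Pi.single i 1 : ι → ℝ)))).comp_hasDerivAt (0 : ℝ) hl
      have h4 := h3.clm_apply (hasDerivAt_const (0 : ℝ) (Z' θ (Pi.single i 1)))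
      simpa using h4
    rw [Finset.sum_congr rfl fun i _ => e2 i, ← integral_finsetSum _ fun i _ =>
      (hG2 θ _ _).integrable]
    refine integral_congr_ae (Filter.Eventually.of_forall fun w => ?_)
    simp only [← Finset.sum_sub_distrib, Finset.mul_sum]
    refine Finset.sum_congr rfl fun i _ => ?_
    -- Each coordinate is killed by `A` or by `B`, so there are no cross terms: what survives is
    -- `sin θ cos θ` times the `A` term, or minus that factor times the `B` term.
    rcases hAB i with h | h <;> simp [hZ, hZ', h] <;> ring
  have hanti : AntitoneOn (fun θ => ∫ w, f (Z θ w) ∂(stdGauss ι)) (Set.Icc 0 (Real.pi / 2)) := by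
    refine antitoneOn_of_deriv_nonpos (convex_Icc _ _)
      (fun θ _ => (hF θ).continuousAt.continuousWithinAt)
      (fun θ _ => (hF θ).differentiableAt.differentiableWithinAt) fun θ hθ => ?_
    rw [interior_Icc] at hθ
    rw [(hF θ).deriv, hderiv]
    refine mul_nonpos_of_nonneg_of_nonpos (mul_nonneg ?_ ?_)
      (integral_nonpos fun w => sub_nonpos.2 (hle _))
    · exact Real.sin_nonneg_of_nonneg_of_le_pi hθ.1.le (by linarith [hθ.2, Real.pi_pos])
    · exact Real.cos_nonneg_of_mem_Icc ⟨by linarith [hθ.1, Real.pi_pos], hθ.2.le⟩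
  have hpi : (0 : ℝ) ≤ Real.pi / 2 := by positivity
  have := hanti (Set.left_mem_Icc.2 hpi) (Set.right_mem_Icc.2 hpi) hpi
  simpa [hZ] using this

end LassoGaussian

/-! ### The soft minimum and its first two derivatives. -/

namespace LassoGaussian

section SoftMin

variable {T κ : Type*} [Fintype T] [Fintype κ]

/-- The derivative of `smoothNorm ε` at `x` in the direction `ξ`. -/
noncomputable def normSlope (ε : ℝ) (x ξ : κ → ℝ) : ℝ :=
  (∑ i, x i * ξ i) / smoothNorm ε x

/-- The second derivative of `smoothNorm ε` at `x` in the directions `ξ` and `η`. -/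
noncomputable def normHess (ε : ℝ) (x ξ η : κ → ℝ) : ℝ :=
  (∑ i, ξ i * η i) / smoothNorm ε x - normSlope ε x ξ * normSlope ε x η / smoothNorm ε x

/-- The value `‖x_t‖ + s_t`, with the norm smoothed. -/
noncomputable def normVal (ε : ℝ) (z : (T → κ → ℝ) × (T → ℝ)) (t : T) : ℝ :=
  smoothNorm ε (z.1 t) + z.2 t

/-- The derivative of `normVal`. -/
noncomputable def valSlope (ε : ℝ) (z ξ : (T → κ → ℝ) × (T → ℝ)) (t : T) : ℝ :=
  normSlope ε (z.1 t) (ξ.1 t) + ξ.2 t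

/-- The partition function of the soft minimum. -/
noncomputable def partFun (ε β : ℝ) (z : (T → κ → ℝ) × (T → ℝ)) : ℝ :=
  ∑ t, Real.exp (-β * normVal ε z t)

/-- The weights of the soft minimum. -/
noncomputable def softWeight (ε β : ℝ) (z : (T → κ → ℝ) × (T → ℝ)) (t : T) : ℝ :=
  Real.exp (-β * normVal ε z t) / partFun ε β z

/-- A smooth version of `exp (-l * min_t (‖x_t‖ + s_t))`. -/
noncomputable def softMin (ε β l : ℝ) (z : (T → κ → ℝ) × (T → ℝ)) : ℝ :=
  Real.exp (l / β * Real.log (partFun ε β z))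

/-- The mean slope with respect to the weights of the soft minimum. -/
noncomputable def meanSlope (ε β : ℝ) (z ξ : (T → κ → ℝ) × (T → ℝ)) : ℝ :=
  ∑ t, softWeight ε β z t * valSlope ε z ξ t

/-- The second derivative of `softMin`, divided by `softMin`. -/
noncomputable def softHess (ε β l : ℝ) (z ξ η : (T → κ → ℝ) × (T → ℝ)) : ℝ :=
  (l ^ 2 - l * β) * (meanSlope ε β z ξ * meanSlope ε β z η)
    + l * β * ∑ t, softWeight ε β z t * (valSlope ε z ξ t * valSlope ε z η t)
    - l * ∑ t, softWeight ε β z t * normHess ε (z.1 t) (ξ.1 t) (η.1 t)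

variable {ε β l : ℝ}

theorem softMin_pos (z : (T → κ → ℝ) × (T → ℝ)) : 0 < softMin ε β l z := Real.exp_pos _

theorem contDiff_smoothNorm (hε : 0 < ε) {n : WithTop ℕ∞} :
    ContDiff ℝ n (smoothNorm ε : (κ → ℝ) → ℝ) := by
  unfold smoothNorm
  refine ContDiff.sqrt (by fun_prop) fun x => ?_
  have : 0 ≤ ∑ i, x i ^ 2 := Finset.sum_nonneg fun _ _ => sq_nonneg _
  linarith

theorem hasDerivAt_line_fst {T κ : Type*} (z ξ : (T → κ → ℝ) × (T → ℝ)) (t : T) (i : κ) :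
    HasDerivAt (fun s : ℝ => (z + s • ξ).1 t i) (ξ.1 t i) 0 := by
  have := ((hasDerivAt_id (0 : ℝ)).mul_const (ξ.1 t i)).const_add (z.1 t i)
  simpa using this

theorem hasDerivAt_normVal {T : Type*} (hε : 0 < ε) (z ξ : (T → κ → ℝ) × (T → ℝ)) (t : T) :
    HasDerivAt (fun s : ℝ => normVal ε (z + s • ξ) t) (valSlope ε z ξ t) 0 := by
  have h1 := hasDerivAt_smoothNorm hε (x := fun s : ℝ => (z + s • ξ).1 t)
    (fun i => hasDerivAt_line_fst z ξ t i)
  have h2 : HasDerivAt (fun s : ℝ => (z + s • ξ).2 t) (ξ.2 t) 0 := by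
    have := ((hasDerivAt_id (0 : ℝ)).mul_const (ξ.2 t)).const_add (z.2 t)
    simpa using this
  have h3 := h1.add h2
  simp only [zero_smul, add_zero] at h3
  exact h3

theorem hasDerivAt_valSlope {T : Type*} (hε : 0 < ε) (z ξ η : (T → κ → ℝ) × (T → ℝ)) (t : T) :
    HasDerivAt (fun s : ℝ => valSlope ε (z + s • ξ) η t)
      (normHess ε (z.1 t) (ξ.1 t) (η.1 t)) 0 := by
  have h1 := hasDerivAt_smoothNorm hε (x := fun s : ℝ => (z + s • ξ).1 t)
    (fun i => hasDerivAt_line_fst z ξ t i)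
  have h2 : HasDerivAt (fun s : ℝ => ∑ i, (z + s • ξ).1 t i * η.1 t i) (∑ i, ξ.1 t i * η.1 t i) 0 :=
    HasDerivAt.fun_sum fun i _ => (hasDerivAt_line_fst z ξ t i).mul_const _
  have hN := (smoothNorm_pos hε (z.1 t)).ne'
  have h3 := (h2.div h1 (by simpa using hN)).add_const (η.2 t)
  simp only [zero_smul, add_zero] at h3
  refine h3.congr_deriv ?_
  simp only [normHess, normSlope]
  field_simp

variable [Nonempty T]

theorem partFun_pos (z : (T → κ → ℝ) × (T → ℝ)) : 0 < partFun ε β z :=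
  Finset.sum_pos (fun _ _ => Real.exp_pos _) Finset.univ_nonempty

theorem softWeight_nonneg (z : (T → κ → ℝ) × (T → ℝ)) (t : T) : 0 ≤ softWeight ε β z t :=
  div_nonneg (Real.exp_pos _).le (partFun_pos z).le

theorem sum_softWeight (z : (T → κ → ℝ) × (T → ℝ)) : ∑ t, softWeight ε β z t = 1 := by
  simp only [softWeight, ← Finset.sum_div]
  exact div_self (partFun_pos z).ne'

theorem contDiff_softMin (hε : 0 < ε) {n : WithTop ℕ∞} :
    ContDiff ℝ n (softMin ε β l : (T → κ → ℝ) × (T → ℝ) → ℝ) := by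
  have h1 : ∀ t, ContDiff ℝ n fun z : (T → κ → ℝ) × (T → ℝ) => normVal ε z t := fun t =>
    ((contDiff_smoothNorm hε).comp (by fun_prop : ContDiff ℝ n
      fun z : (T → κ → ℝ) × (T → ℝ) => z.1 t)).add (by fun_prop)
  have h2 : ContDiff ℝ n (partFun ε β : (T → κ → ℝ) × (T → ℝ) → ℝ) :=
    ContDiff.sum fun t _ => (contDiff_const.mul (h1 t)).exp
  exact (contDiff_const.mul (h2.log fun z => (partFun_pos z).ne')).exp

theorem hasDerivAt_partFun (hε : 0 < ε) (z ξ : (T → κ → ℝ) × (T → ℝ)) :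
    HasDerivAt (fun s : ℝ => partFun ε β (z + s • ξ))
      (partFun ε β z * (-β * meanSlope ε β z ξ)) 0 := by
  have h := HasDerivAt.fun_sum (u := Finset.univ) fun t _ =>
    ((hasDerivAt_normVal hε z ξ t).const_mul (-β)).exp
  simp only [zero_smul, add_zero] at h
  refine h.congr_deriv ?_
  simp only [meanSlope, softWeight, Finset.mul_sum]
  refine Finset.sum_congr rfl fun t _ => ?_
  have := (partFun_pos (ε := ε) (β := β) z).ne'
  field_simp

theorem hasDerivAt_softMin (hε : 0 < ε) (hβ : β ≠ 0) (z ξ : (T → κ → ℝ) × (T → ℝ)) :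
    HasDerivAt (fun s : ℝ => softMin ε β l (z + s • ξ))
      (softMin ε β l z * (-l * meanSlope ε β z ξ)) 0 := by
  have hp := (partFun_pos (ε := ε) (β := β) z).ne'
  have h := (((hasDerivAt_partFun hε z ξ (β := β)).log (by simpa using hp)).const_mul (l / β)).exp
  simp only [zero_smul, add_zero] at h
  refine h.congr_deriv ?_
  rw [softMin]
  field_simp

theorem hasDerivAt_softWeight (hε : 0 < ε) (z ξ : (T → κ → ℝ) × (T → ℝ)) (t : T) :
    HasDerivAt (fun s : ℝ => softWeight ε β (z + s • ξ) t)
      (softWeight ε β z t * (-β * valSlope ε z ξ t + β * meanSlope ε β z ξ)) 0 := by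
  have hp := (partFun_pos (ε := ε) (β := β) z).ne'
  have h := (((hasDerivAt_normVal hε z ξ t).const_mul (-β)).exp).div
    (hasDerivAt_partFun hε z ξ (β := β)) (by simpa using hp)
  simp only [zero_smul, add_zero] at h
  refine h.congr_deriv ?_
  rw [softWeight]
  field_simp
  ring

/-- Differentiating the weights gives `-β` times the covariance of the slopes, differentiating the
slopes gives the mean Hessian of the norms, and differentiating the prefactor gives the term `l ^
2`. -/
theorem hasDerivAt_softMin_mul_meanSlope (hε : 0 < ε) (hβ : β ≠ 0)
    (z ξ η : (T → κ → ℝ) × (T → ℝ)) :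
    HasDerivAt (fun s : ℝ => softMin ε β l (z + s • ξ) * (-l * meanSlope ε β (z + s • ξ) η))
      (softMin ε β l z * softHess ε β l z ξ η) 0 := by
  have hm : HasDerivAt (fun s : ℝ => meanSlope ε β (z + s • ξ) η) _ 0 :=
    HasDerivAt.fun_sum (u := Finset.univ) fun t _ =>
      (hasDerivAt_softWeight hε z ξ t (β := β)).mul (hasDerivAt_valSlope hε z ξ η t)
  have h := (hasDerivAt_softMin hε hβ z ξ (l := l)).mul (hm.const_mul (-l))
  simp only [zero_smul, add_zero] at h
  refine h.congr_deriv ?_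
  have e : ∑ t, (softWeight ε β z t * (-β * valSlope ε z ξ t + β * meanSlope ε β z ξ)
      * valSlope ε z η t + softWeight ε β z t * normHess ε (z.1 t) (ξ.1 t) (η.1 t)) =
      -β * ∑ t, softWeight ε β z t * (valSlope ε z ξ t * valSlope ε z η t)
      + β * meanSlope ε β z ξ * meanSlope ε β z η
      + ∑ t, softWeight ε β z t * normHess ε (z.1 t) (ξ.1 t) (η.1 t) := by
    rw [meanSlope.eq_1 ε β z η, Finset.mul_sum, Finset.mul_sum, ← Finset.sum_add_distrib,
      ← Finset.sum_add_distrib]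
    exact Finset.sum_congr rfl fun t _ => by ring
  rw [e, softHess]
  ring

/-- Smoothness is already known, so the Fréchet derivatives can be read off from derivatives along
lines. -/
theorem fderiv_softMin (hε : 0 < ε) (hβ : β ≠ 0) (z ξ : (T → κ → ℝ) × (T → ℝ)) :
    fderiv ℝ (softMin ε β l) z ξ = softMin ε β l z * (-l * meanSlope ε β z ξ) := by
  have h1 : DifferentiableAt ℝ (softMin ε β l : (T → κ → ℝ) × (T → ℝ) → ℝ) z :=
    (contDiff_softMin hε (n := 1)).differentiable (by norm_num) z
  rw [← h1.lineDeriv_eq_fderiv]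
  exact (show HasLineDerivAt ℝ _ _ _ _ from hasDerivAt_softMin hε hβ z ξ).lineDeriv

theorem fderiv_fderiv_softMin (hε : 0 < ε) (hβ : β ≠ 0) (z ξ η : (T → κ → ℝ) × (T → ℝ)) :
    fderiv ℝ (fderiv ℝ (softMin ε β l)) z ξ η = softMin ε β l z * softHess ε β l z ξ η := by
  have h1 : DifferentiableAt ℝ (fderiv ℝ (softMin ε β l : (T → κ → ℝ) × (T → ℝ) → ℝ)) z :=
    ((contDiff_softMin hε (n := 2)).fderiv_right (m := 1) (by norm_num)).differentiable
      (by norm_num) z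
  have h2 : HasDerivAt (fun s : ℝ => fderiv ℝ (softMin ε β l) (z + s • ξ) η)
      (fderiv ℝ (fderiv ℝ (softMin ε β l)) z ξ η) 0 := by
    have h3 : HasDerivAt (fun s : ℝ => fderiv ℝ (softMin ε β l) (z + s • ξ))
        (fderiv ℝ (fderiv ℝ (softMin ε β l)) z ξ) 0 := h1.hasFDerivAt.hasLineDerivAt ξ
    simpa using h3.clm_apply (hasDerivAt_const (0 : ℝ) η)
  simp only [fderiv_softMin hε hβ] at h2
  exact h2.unique (hasDerivAt_softMin_mul_meanSlope hε hβ z ξ η)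

theorem abs_sum_softWeight_mul_le (z : (T → κ → ℝ) × (T → ℝ)) {x : T → ℝ} {b : ℝ}
    (hx : ∀ t, |x t| ≤ b) : |∑ t, softWeight ε β z t * x t| ≤ b := by
  calc |∑ t, softWeight ε β z t * x t| ≤ ∑ t, |softWeight ε β z t * x t| :=
        Finset.abs_sum_le_sum_abs _ _
    _ ≤ ∑ t, softWeight ε β z t * b := Finset.sum_le_sum fun t _ => by
        rw [abs_mul, abs_of_nonneg (softWeight_nonneg z t)]
        exact mul_le_mul_of_nonneg_left (hx t) (softWeight_nonneg z t)
    _ = b := by rw [← Finset.sum_mul, sum_softWeight, one_mul]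

theorem abs_fst_apply_le {T : Type*} [Fintype T] (ξ : (T → κ → ℝ) × (T → ℝ)) (t : T) (i : κ) :
    |ξ.1 t i| ≤ ‖ξ‖ :=
  (norm_le_pi_norm (ξ.1 t) i).trans ((norm_le_pi_norm ξ.1 t).trans (norm_fst_le ξ))

theorem abs_snd_apply_le {T : Type*} [Fintype T] (ξ : (T → κ → ℝ) × (T → ℝ)) (t : T) :
    |ξ.2 t| ≤ ‖ξ‖ :=
  (norm_le_pi_norm ξ.2 t).trans (norm_snd_le ξ)

theorem abs_normSlope_le {T : Type*} [Fintype T] (hε : 0 < ε) (x : κ → ℝ)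
    (ξ : (T → κ → ℝ) × (T → ℝ)) (t : T) :
    |normSlope ε x (ξ.1 t)| ≤ Fintype.card κ * ‖ξ‖ := by
  rw [normSlope, abs_div, abs_of_pos (smoothNorm_pos hε x), div_le_iff₀ (smoothNorm_pos hε x)]
  calc |∑ i, x i * ξ.1 t i| ≤ ∑ i, |x i * ξ.1 t i| := Finset.abs_sum_le_sum_abs _ _
    _ ≤ ∑ _i : κ, smoothNorm ε x * ‖ξ‖ := Finset.sum_le_sum fun i _ => by
        rw [abs_mul]
        exact mul_le_mul (abs_apply_le_smoothNorm hε.le x i) (abs_fst_apply_le ξ t i)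
          (abs_nonneg _) (smoothNorm_nonneg x)
    _ = _ := by simp; ring

theorem abs_valSlope_le {T : Type*} [Fintype T] (hε : 0 < ε) (z ξ : (T → κ → ℝ) × (T → ℝ)) (t : T) :
    |valSlope ε z ξ t| ≤ (Fintype.card κ + 1) * ‖ξ‖ := by
  rw [add_mul, one_mul]
  exact (abs_add_le _ _).trans
    (add_le_add (abs_normSlope_le hε _ ξ t) (abs_snd_apply_le ξ t))

theorem abs_normHess_le {T : Type*} [Fintype T] (hε : 0 < ε) (x : κ → ℝ)
    (ξ η : (T → κ → ℝ) × (T → ℝ)) (t : T) :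
    |normHess ε x (ξ.1 t) (η.1 t)| ≤
      ((Fintype.card κ + Fintype.card κ ^ 2) / √ε) * (‖ξ‖ * ‖η‖) := by
  have hs := Real.sqrt_pos.2 hε
  have hN := smoothNorm_pos hε x
  have hi : (smoothNorm ε x)⁻¹ ≤ (√ε)⁻¹ := inv_anti₀ hs (sqrt_le_smoothNorm x)
  rw [normHess, ← sub_div, abs_div, abs_of_pos hN, div_eq_mul_inv]
  have h1 : |∑ i, ξ.1 t i * η.1 t i| ≤ Fintype.card κ * (‖ξ‖ * ‖η‖) := by
    calc |∑ i, ξ.1 t i * η.1 t i| ≤ ∑ i, |ξ.1 t i * η.1 t i| := Finset.abs_sum_le_sum_abs _ _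
      _ ≤ ∑ _i : κ, ‖ξ‖ * ‖η‖ := Finset.sum_le_sum fun i _ => by
          rw [abs_mul]
          exact mul_le_mul (abs_fst_apply_le ξ t i) (abs_fst_apply_le η t i)
            (abs_nonneg _) (norm_nonneg _)
      _ = _ := by simp
  have h2 : |normSlope ε x (ξ.1 t) * normSlope ε x (η.1 t)| ≤
      (Fintype.card κ * ‖ξ‖) * (Fintype.card κ * ‖η‖) := by
    rw [abs_mul]
    exact mul_le_mul (abs_normSlope_le hε x ξ t) (abs_normSlope_le hε x η t) (abs_nonneg _)
      (by positivity)
  calc _ ≤ (Fintype.card κ * (‖ξ‖ * ‖η‖) + (Fintype.card κ * ‖ξ‖) * (Fintype.card κ * ‖η‖))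
        * (√ε)⁻¹ := mul_le_mul ((abs_sub _ _).trans (add_le_add h1 h2)) hi
          (inv_nonneg.2 hN.le) (by positivity)
    _ = _ := by ring

theorem abs_meanSlope_le (hε : 0 < ε) (z ξ : (T → κ → ℝ) × (T → ℝ)) :
    |meanSlope ε β z ξ| ≤ (Fintype.card κ + 1) * ‖ξ‖ :=
  abs_sum_softWeight_mul_le z (abs_valSlope_le hε z ξ)

/-- The constant depends on the dimension and on `ε`, which is harmless: it only justifies
integrability and differentiation under the integral. -/
theorem abs_softHess_le (hε : 0 < ε) (z ξ η : (T → κ → ℝ) × (T → ℝ)) :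
    |softHess ε β l z ξ η| ≤ (|l ^ 2 - l * β| * (Fintype.card κ + 1) ^ 2
      + |l * β| * (Fintype.card κ + 1) ^ 2
      + |l| * ((Fintype.card κ + Fintype.card κ ^ 2) / √ε)) * (‖ξ‖ * ‖η‖) := by
  have h1 : |meanSlope ε β z ξ * meanSlope ε β z η| ≤
      ((Fintype.card κ + 1) * ‖ξ‖) * ((Fintype.card κ + 1) * ‖η‖) := by
    rw [abs_mul]
    exact mul_le_mul (abs_meanSlope_le hε z ξ) (abs_meanSlope_le hε z η) (abs_nonneg _)
      (by positivity)
  have h2 : |∑ t, softWeight ε β z t * (valSlope ε z ξ t * valSlope ε z η t)| ≤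
      ((Fintype.card κ + 1) * ‖ξ‖) * ((Fintype.card κ + 1) * ‖η‖) := by
    refine abs_sum_softWeight_mul_le z fun t => ?_
    rw [abs_mul]
    exact mul_le_mul (abs_valSlope_le hε z ξ t) (abs_valSlope_le hε z η t) (abs_nonneg _)
      (by positivity)
  have h3 : |∑ t, softWeight ε β z t * normHess ε (z.1 t) (ξ.1 t) (η.1 t)| ≤
      ((Fintype.card κ + Fintype.card κ ^ 2) / √ε) * (‖ξ‖ * ‖η‖) :=
    abs_sum_softWeight_mul_le z fun t => abs_normHess_le hε _ ξ η t
  rw [softHess]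
  refine (abs_sub _ _).trans ((add_le_add (abs_add_le _ _) le_rfl).trans ?_)
  rw [abs_mul, abs_mul (l * β), abs_mul l (∑ t, _)]
  refine (add_le_add (add_le_add (mul_le_mul_of_nonneg_left h1 (abs_nonneg _))
    (mul_le_mul_of_nonneg_left h2 (abs_nonneg _)))
    (mul_le_mul_of_nonneg_left h3 (abs_nonneg l))).trans_eq ?_
  ring

/-- Together with `le_softMin` this sandwiches the soft minimum; the excess factor `|T| ^ (l / β)`
disappears as `β → ∞`. -/
theorem softMin_le (hβ : 0 < β) (hl : 0 ≤ l) (z : (T → κ → ℝ) × (T → ℝ)) {b : ℝ}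
    (hb : ∀ t, b ≤ normVal ε z t) :
    softMin ε β l z ≤ Real.exp (l / β * Real.log (Fintype.card T)) * Real.exp (-l * b) := by
  rw [softMin, ← Real.exp_add]
  refine Real.exp_le_exp.2 ?_
  have hT : (0 : ℝ) < Fintype.card T := Nat.cast_pos.2 Fintype.card_pos
  have h1 : partFun ε β z ≤ Fintype.card T * Real.exp (-β * b) := by
    refine (Finset.sum_le_card_nsmul _ _ (Real.exp (-β * b)) fun t _ => ?_).trans_eq (by simp)
    refine Real.exp_le_exp.2 ?_
    have := mul_le_mul_of_nonneg_left (hb t) hβ.le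
    linarith
  have h2 : Real.log (partFun ε β z) ≤ Real.log (Fintype.card T) + -β * b := by
    refine (Real.log_le_log (partFun_pos z) h1).trans_eq ?_
    rw [Real.log_mul hT.ne' (Real.exp_pos _).ne', Real.log_exp]
  refine (mul_le_mul_of_nonneg_left h2 (by positivity)).trans_eq ?_
  field_simp

theorem le_softMin {T : Type*} [Fintype T] (hβ : 0 < β) (hl : 0 ≤ l) (z : (T → κ → ℝ) × (T → ℝ))
    (t : T) :
    Real.exp (-l * normVal ε z t) ≤ softMin ε β l z := by
  rw [softMin]
  refine Real.exp_le_exp.2 ?_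
  have h1 : Real.exp (-β * normVal ε z t) ≤ partFun ε β z :=
    Finset.single_le_sum (f := fun t => Real.exp (-β * normVal ε z t))
      (fun _ _ => (Real.exp_pos _).le) (Finset.mem_univ t)
  have h2 := Real.log_le_log (Real.exp_pos _) h1
  rw [Real.log_exp] at h2
  refine le_trans (le_of_eq ?_) (mul_le_mul_of_nonneg_left h2 (by positivity))
  field_simp

theorem softMin_le_exp_norm (hβ : 0 < β) (hl : 0 ≤ l) (z : (T → κ → ℝ) × (T → ℝ)) :
    softMin ε β l z ≤ Real.exp (l / β * Real.log (Fintype.card T)) * Real.exp (l * ‖z‖) := by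
  have := softMin_le hβ hl z (b := -‖z‖) (ε := ε) fun t => by
    have h1 := abs_le.1 (abs_snd_apply_le z t)
    have h2 := smoothNorm_nonneg (ε := ε) (z.1 t)
    rw [normVal]; linarith
  simpa using this

end SoftMin

end LassoGaussian

/-! ### Gordon's comparison of the two Gaussian processes. -/

namespace LassoGaussian

section Gordon

variable {T κ D : Type*} [Fintype κ] [Fintype D]

/-- The indices of the Gaussian coordinates used in Gordon's comparison. -/
abbrev GordonIdx (κ D : Type*) := ((κ × D) ⊕ Unit) ⊕ (κ ⊕ D)

/-- The process `(G v_t, γ)`. -/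
noncomputable def gordonA (κ : Type*) [Fintype κ] (V : T → D → ℝ) :
    (GordonIdx κ D → ℝ) →L[ℝ] (T → κ → ℝ) × (T → ℝ) :=
  LinearMap.toContinuousLinearMap
    { toFun := fun w => (fun t i => ∑ j, V t j * w (.inl (.inl (i, j))),
        fun _ => w (.inl (.inr ())))
      map_add' := fun w w' => by
        ext <;> simp [mul_add, Finset.sum_add_distrib]
      map_smul' := fun c w => by
        ext <;> simp [Finset.mul_sum, mul_left_comm] }

/-- The process `(g, ⟨h, v_t⟩)`. -/
noncomputable def gordonB (κ : Type*) [Fintype κ] (V : T → D → ℝ) :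
    (GordonIdx κ D → ℝ) →L[ℝ] (T → κ → ℝ) × (T → ℝ) :=
  LinearMap.toContinuousLinearMap
    { toFun := fun w => (fun _ i => w (.inr (.inl i)),
        fun t => ∑ j, V t j * w (.inr (.inr j)))
      map_add' := fun w w' => by
        ext <;> simp [mul_add, Finset.sum_add_distrib]
      map_smul' := fun c w => by
        ext <;> simp [Finset.mul_sum, mul_left_comm] }

theorem gordonA_apply (V : T → D → ℝ) (w : GordonIdx κ D → ℝ) :
    gordonA κ V w = (fun t i => ∑ j, V t j * w (.inl (.inl (i, j))),
      fun _ => w (.inl (.inr ()))) := rfl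

theorem gordonB_apply (V : T → D → ℝ) (w : GordonIdx κ D → ℝ) :
    gordonB κ V w = (fun _ i => w (.inr (.inl i)),
      fun t => ∑ j, V t j * w (.inr (.inr j))) := rfl

variable [DecidableEq κ] [DecidableEq D]

theorem gordonA_single_inl (V : T → D → ℝ) (i : κ) (j : D) :
    gordonA κ V (Pi.single (.inl (.inl (i, j))) 1) = (fun t => Pi.single i (V t j), 0) := by
  rw [gordonA_apply]
  refine Prod.ext (funext fun t => funext fun i' => ?_) (funext fun t => ?_)
  · by_cases h : i' = i
    · subst h
      simp [Pi.single_apply]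
    · simp [h]
  · simp

theorem gordonA_single_unit (V : T → D → ℝ) :
    gordonA κ V (Pi.single (.inl (.inr ())) 1) = (0, 1) := by
  rw [gordonA_apply]
  refine Prod.ext (funext fun t => funext fun i' => ?_) (funext fun t => ?_)
  · simp
  · simp

theorem gordonA_single_inr (V : T → D → ℝ) (k : κ ⊕ D) :
    gordonA κ V (Pi.single (.inr k) 1) = 0 := by
  rw [gordonA_apply]
  refine Prod.ext (funext fun t => funext fun i' => ?_) (funext fun t => ?_) <;>
  simp

theorem gordonB_single_inl (V : T → D → ℝ) (k : (κ × D) ⊕ Unit) :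
    gordonB κ V (Pi.single (.inl k) 1) = 0 := by
  rw [gordonB_apply]
  refine Prod.ext (funext fun t => funext fun i' => ?_) (funext fun t => ?_) <;>
  simp

theorem gordonB_single_norm (V : T → D → ℝ) (i : κ) :
    gordonB κ V (Pi.single (.inr (.inl i)) 1) = (fun _ => Pi.single i 1, 0) := by
  rw [gordonB_apply]
  refine Prod.ext (funext fun t => funext fun i' => ?_) (funext fun t => ?_) <;>
  simp [Pi.single_apply]

theorem gordonB_single_inner (V : T → D → ℝ) (j : D) :
    gordonB κ V (Pi.single (.inr (.inr j)) 1) = (0, fun t => V t j) := by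
  rw [gordonB_apply]
  refine Prod.ext (funext fun t => funext fun i' => ?_) (funext fun t => ?_) <;>
  simp [Pi.single_apply]

theorem normSlope_single (ε : ℝ) (x : κ → ℝ) (i : κ) (a : ℝ) :
    normSlope ε x (Pi.single i a) = x i / smoothNorm ε x * a := by
  simp [normSlope, Pi.single_apply]; ring

theorem normHess_single (ε : ℝ) (x : κ → ℝ) (i : κ) (a : ℝ) :
    normHess ε x (Pi.single i a) (Pi.single i a) =
      (1 / smoothNorm ε x - (x i / smoothNorm ε x) ^ 2 / smoothNorm ε x) * a ^ 2 := by
  rw [normHess, normSlope_single]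
  simp [Pi.single_apply]; ring

theorem normSlope_zero {κ : Type*} [Fintype κ] (ε : ℝ) (x : κ → ℝ) :
    normSlope ε x 0 = 0 := by simp [normSlope]

theorem normHess_zero {κ : Type*} [Fintype κ] (ε : ℝ) (x : κ → ℝ) : normHess ε x 0 0 = 0 := by
  simp [normHess, normSlope_zero]

variable [Fintype T]

/-- Brings squared means into the form of weighted sums over pairs `(t, u)`, where the two
covariance kernels can be compared pointwise. -/
theorem sum_sq_sum_mul {I : Type*} [Fintype I] (p : T → ℝ) (x : T → I → ℝ) :
    ∑ i, (∑ t, p t * x t i) * (∑ t, p t * x t i) =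
      ∑ t, ∑ u, p t * p u * ∑ i, x t i * x u i := by
  simp only [Finset.sum_mul_sum]
  simp only [Finset.mul_sum]
  rw [Finset.sum_comm]
  refine Finset.sum_congr rfl fun t _ => ?_
  rw [Finset.sum_comm]
  exact Finset.sum_congr rfl fun u _ => Finset.sum_congr rfl fun i _ => by ring

/-- Both processes have the same variances, so the terms with a single index `t` coincide. The
difference of the sides is `l ^ 2 - l * β ≤ 0` times a weighted sum over pairs of `(1 - ⟨g_t, g_u⟩)
(1 - ⟨v_t, v_u⟩)`, where `g_t` is the gradient of the smoothed norm; both factors are nonnegative,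
since `‖g_t‖ ≤ 1` and `‖v_t‖ = 1`. -/
theorem sum_softHess_gordon_le [Nonempty T] {ε β l : ℝ} (hε : 0 < ε) (hl : 0 ≤ l) (hlβ : l ≤ β)
    {V : T → D → ℝ} (hV : ∀ t, ∑ j, V t j ^ 2 = 1) (z : (T → κ → ℝ) × (T → ℝ)) :
    ∑ i, softHess ε β l z (gordonA κ V (Pi.single i 1)) (gordonA κ V (Pi.single i 1)) ≤
      ∑ i, softHess ε β l z (gordonB κ V (Pi.single i 1)) (gordonB κ V (Pi.single i 1)) := by
  set p := softWeight ε β z with hp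
  set g : T → κ → ℝ := fun t i => z.1 t i / smoothNorm ε (z.1 t) with hg
  have hp0 : ∀ t, 0 ≤ p t := softWeight_nonneg z
  have hp1 : ∑ t, p t = 1 := sum_softWeight z
  have hzero : softHess ε β l z 0 0 = 0 := by
    simp [softHess, meanSlope, valSlope, normSlope_zero, normHess_zero]
  have hA1 : ∀ i j t, valSlope ε z (fun t => Pi.single i (V t j), 0) t = g t i * V t j := by
    intro i j t
    simp [valSlope, normSlope_single, hg]
  have hA2 : ∀ t, valSlope ε z (0, 1) t = 1 := by
    intro t; simp [valSlope, normSlope_zero]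
  have hB1 : ∀ i t, valSlope ε z (fun _ => Pi.single i 1, 0) t = g t i := by
    intro i t; simp [valSlope, normSlope_single, hg]
  have hB2 : ∀ j t, valSlope ε z (0, fun t => V t j) t = V t j := by
    intro j t; simp [valSlope, normSlope_zero]
  -- The Hessian is quadratic in its direction, so `∑ j, V t j ^ 2 = 1` makes the Hessian terms of
  -- the two processes equal.
  have hH : ∀ t, ∀ i, normHess ε (z.1 t) (Pi.single i 1) (Pi.single i 1) =
      ∑ j, normHess ε (z.1 t) (Pi.single i (V t j)) (Pi.single i (V t j)) := by
    intro t i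
    simp only [normHess_single, ← Finset.mul_sum, hV]
    norm_num
  have hgg : ∀ t u, ∑ i, g t i * g u i ≤ 1 := by
    intro t u
    have hn : ∀ t, ∑ i, g t i ^ 2 ≤ 1 := by
      intro t
      simp only [hg, div_pow, ← Finset.sum_div]
      exact div_le_one_of_le₀ (sum_sq_le_sq_smoothNorm hε.le _) (sq_nonneg _)
    have : ∀ i, g t i * g u i ≤ (g t i ^ 2 + g u i ^ 2) / 2 := fun i => by
      linarith [two_mul_le_add_sq (g t i) (g u i)]
    refine (Finset.sum_le_sum fun i _ => this i).trans ?_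
    rw [← Finset.sum_div, Finset.sum_add_distrib]
    linarith [hn t, hn u]
  have hVV : ∀ t u, ∑ j, V t j * V u j ≤ 1 := by
    intro t u
    have : ∀ i, V t i * V u i ≤ (V t i ^ 2 + V u i ^ 2) / 2 := fun i => by
      linarith [two_mul_le_add_sq (V t i) (V u i)]
    refine (Finset.sum_le_sum fun i _ => this i).trans ?_
    rw [← Finset.sum_div, Finset.sum_add_distrib, hV, hV]
    norm_num
  simp only [Fintype.sum_sum_type, Fintype.sum_prod_type, gordonA_single_inl, gordonB_single_inl,
    gordonA_single_inr, gordonB_single_norm, gordonB_single_inner, hzero, Finset.sum_const_zero,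
    add_zero, zero_add, Finset.univ_unique, Finset.sum_singleton, PUnit.default_eq_unit,
    gordonA_single_unit]
  simp only [softHess, meanSlope, hA1, hA2, hB1, hB2, ← hp, normHess_zero, mul_zero, mul_one,
    Finset.sum_const_zero, sub_zero, Pi.zero_apply, hp1]
  simp only [Finset.sum_add_distrib, Finset.sum_sub_distrib, ← Finset.mul_sum]
  have e1 : ∑ i : κ, ∑ j : D, (∑ t, p t * (g t i * V t j)) * (∑ t, p t * (g t i * V t j)) =
      ∑ t, ∑ u, p t * p u * ((∑ i, g t i * g u i) * ∑ j, V t j * V u j) := by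
    have := sum_sq_sum_mul p (fun t (q : κ × D) => g t q.1 * V t q.2)
    simp only [Fintype.sum_prod_type] at this
    rw [this]
    refine Finset.sum_congr rfl fun t _ => Finset.sum_congr rfl fun u _ => ?_
    rw [Finset.sum_mul_sum]
    congr 1
    exact Finset.sum_congr rfl fun i _ => Finset.sum_congr rfl fun j _ => by ring
  have e2 := sum_sq_sum_mul p g
  have e3 := sum_sq_sum_mul p V
  have e4 : ∑ i : κ, ∑ j : D, ∑ t, p t * (g t i * V t j * (g t i * V t j)) =
      ∑ i, ∑ t, p t * (g t i * g t i) := by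
    refine Finset.sum_congr rfl fun i _ => ?_
    rw [Finset.sum_comm]
    refine Finset.sum_congr rfl fun t _ => ?_
    rw [← mul_one (p t * _), ← hV t, Finset.mul_sum]
    exact Finset.sum_congr rfl fun j _ => by ring
  have e5 : ∑ j : D, ∑ t, p t * (V t j * V t j) = 1 := by
    rw [Finset.sum_comm, ← hp1]
    refine Finset.sum_congr rfl fun t _ => ?_
    have h : ∑ j, V t j * V t j = 1 := by simpa only [pow_two] using hV t
    rw [← Finset.mul_sum, h, mul_one]
  have e6 : ∑ i : κ, ∑ j : D, ∑ t, p t * normHess ε (z.1 t) (Pi.single i (V t j))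
      (Pi.single i (V t j)) = ∑ i : κ, ∑ t, p t * normHess ε (z.1 t) (Pi.single i 1)
      (Pi.single i 1) := by
    refine Finset.sum_congr rfl fun i _ => ?_
    rw [Finset.sum_comm]
    refine Finset.sum_congr rfl fun t _ => ?_
    rw [hH, Finset.mul_sum]
  have e7 : (1 : ℝ) = ∑ t, ∑ u, p t * p u := by
    rw [← Finset.sum_mul_sum, hp1, one_mul]
  -- With `a = ⟨g_t, g_u⟩` and `b = ⟨v_t, v_u⟩` the summand is `p_t p_u (a b + 1 - a - b) = p_t p_u
  -- (1 - a) (1 - b)`.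
  have key : 0 ≤ (∑ i : κ, ∑ j : D, (∑ t, p t * (g t i * V t j)) * (∑ t, p t * (g t i * V t j)))
      + 1 - ∑ i, (∑ t, p t * g t i) * (∑ t, p t * g t i)
      - ∑ j, (∑ t, p t * V t j) * (∑ t, p t * V t j) := by
    rw [e1, e2, e3, e7, ← Finset.sum_add_distrib, ← Finset.sum_sub_distrib,
      ← Finset.sum_sub_distrib]
    refine Finset.sum_nonneg fun t _ => ?_
    rw [← Finset.sum_add_distrib, ← Finset.sum_sub_distrib, ← Finset.sum_sub_distrib]
    refine Finset.sum_nonneg fun u _ => ?_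
    have := mul_nonneg (mul_nonneg (hp0 t) (hp0 u))
      (mul_nonneg (sub_nonneg.2 (hgg t u)) (sub_nonneg.2 (hVV t u)))
    linarith
  rw [e4, e5, e6]
  have hneg : l ^ 2 - l * β ≤ 0 := by nlinarith
  have := mul_nonneg (neg_nonneg.2 hneg) key
  linarith

theorem gordon_softMin [Nonempty T] {ε β l : ℝ} (hε : 0 < ε) (hl : 0 ≤ l) (hβ : 0 < β)
    (hlβ : l ≤ β) {V : T → D → ℝ} (hV : ∀ t, ∑ j, V t j ^ 2 = 1) :
    ∫ w, softMin ε β l (gordonA κ V w) ∂(stdGauss (GordonIdx κ D)) ≤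
      ∫ w, softMin ε β l (gordonB κ V w) ∂(stdGauss (GordonIdx κ D)) := by
  set m : ℝ := (Fintype.card κ : ℝ) with hm
  set C0 : ℝ := Real.exp (l / β * Real.log (Fintype.card T)) with hC0
  set C2 : ℝ := |l ^ 2 - l * β| * (m + 1) ^ 2 + |l * β| * (m + 1) ^ 2
      + |l| * ((m + m ^ 2) / √ε) with hC2
  have hm0 : 0 ≤ m := Nat.cast_nonneg _
  have hC0p : 0 < C0 := Real.exp_pos _
  have hC2p : 0 ≤ C2 := by positivity
  have hb : ∀ z : (T → κ → ℝ) × (T → ℝ), softMin ε β l z ≤ C0 * Real.exp (l * ‖z‖) :=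
    softMin_le_exp_norm hβ hl
  set C : ℝ := C0 * (1 + l * (m + 1) + C2) with hC
  have hCa : C0 ≤ C := by
    rw [hC]; exact le_mul_of_one_le_right hC0p.le (by nlinarith [mul_nonneg hl hm0])
  have hCb : C0 * (l * (m + 1)) ≤ C := by
    rw [hC]; exact mul_le_mul_of_nonneg_left (by linarith) hC0p.le
  have hCc : C0 * C2 ≤ C := by
    rw [hC]; exact mul_le_mul_of_nonneg_left (by nlinarith [mul_nonneg hl hm0]) hC0p.le
  refine integral_comp_le_of_sum_fderiv_le (contDiff_softMin hε) (gordonA κ V) (gordonB κ V)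
    (C := C) (c := l) (hC0p.le.trans hCa) hl (fun z => ?_) (fun z ξ => ?_) (fun z ξ η => ?_)
    (fun i => ?_) fun z => ?_
  · rw [abs_of_pos (softMin_pos z)]
    exact (hb z).trans (mul_le_mul_of_nonneg_right hCa (Real.exp_pos _).le)
  · rw [fderiv_softMin hε hβ.ne', abs_mul, abs_of_pos (softMin_pos z)]
    have h1 : |-l * meanSlope ε β z ξ| ≤ l * ((m + 1) * ‖ξ‖) := by
      rw [abs_mul, abs_neg, abs_of_nonneg hl]
      exact mul_le_mul_of_nonneg_left (abs_meanSlope_le hε z ξ) hl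
    calc _ ≤ (C0 * Real.exp (l * ‖z‖)) * (l * ((m + 1) * ‖ξ‖)) :=
          mul_le_mul (hb z) h1 (abs_nonneg _) (by positivity)
      _ = C0 * (l * (m + 1)) * (Real.exp (l * ‖z‖) * ‖ξ‖) := by ring
      _ ≤ C * (Real.exp (l * ‖z‖) * ‖ξ‖) := mul_le_mul_of_nonneg_right hCb (by positivity)
      _ = _ := by ring
  · rw [fderiv_fderiv_softMin hε hβ.ne', abs_mul, abs_of_pos (softMin_pos z)]
    calc _ ≤ (C0 * Real.exp (l * ‖z‖)) * (C2 * (‖ξ‖ * ‖η‖)) :=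
          mul_le_mul (hb z) (abs_softHess_le hε z ξ η) (abs_nonneg _) (by positivity)
      _ = C0 * C2 * (Real.exp (l * ‖z‖) * (‖ξ‖ * ‖η‖)) := by ring
      _ ≤ C * (Real.exp (l * ‖z‖) * (‖ξ‖ * ‖η‖)) := mul_le_mul_of_nonneg_right hCc (by positivity)
      _ = _ := by ring
  · rcases i with i | i
    · exact Or.inr (gordonB_single_inl V i)
    · exact Or.inl (gordonA_single_inr V i)
  · simp only [fderiv_fderiv_softMin hε hβ.ne', ← Finset.mul_sum]
    exact mul_le_mul_of_nonneg_left (sum_softHess_gordon_le hε hl hlβ hV z) (softMin_pos z).le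

end Gordon

end LassoGaussian

/-! ### Small values of `‖G v‖` for finitely many directions. -/

namespace LassoGaussian

theorem integral_stdGauss_sum_mul {ι ι' : Type*} [Fintype ι] [Fintype ι'] (F : (ι → ℝ) → ℝ)
    (H : (ι' → ℝ) → ℝ) :
    ∫ w : ι ⊕ ι' → ℝ, F (fun i => w (.inl i)) * H (fun j => w (.inr j)) ∂(stdGauss (ι ⊕ ι')) =
      (∫ u, F u ∂(stdGauss ι)) * ∫ v, H v ∂(stdGauss ι') := by
  have h := measurePreserving_sumPiEquivProdPi (fun _ : ι ⊕ ι' => gaussianReal 0 1)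
  rw [← integral_prod_mul, ← h.integral_comp']
  rfl

theorem integral_stdGauss_unit_exp (l : ℝ) :
    ∫ w : Unit → ℝ, Real.exp (l * w ()) ∂(stdGauss Unit) = Real.exp (l ^ 2 / 2) := by
  have h := measurePreserving_eval (fun _ : Unit => gaussianReal 0 1) ()
  have h2 : ∫ x, Real.exp (l * x) ∂(gaussianReal 0 1) = Real.exp (l ^ 2 / 2) := by
    have := congrFun (mgf_id_gaussianReal (μ := 0) (v := 1)) l
    simpa [mgf] using this
  rw [← h2, ← h.map_eq, integral_map h.aemeasurable (by fun_prop)]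

variable {T κ D : Type*} [Fintype T] [Fintype κ] [Fintype D]

theorem continuous_mulVec_prod {T κ : Type*} (V : T → D → ℝ) (t : T) :
    Continuous fun G : κ × D → ℝ => fun i => ∑ j, V t j * G (i, j) := by fun_prop

/-- The event that some `G v_t` has norm less than `c`. -/
def smallImage (V : T → D → ℝ) (c : ℝ) : Set (κ × D → ℝ) :=
  {G | ∃ t, smoothNorm 0 (fun i => ∑ j, V t j * G (i, j)) < c}

theorem isOpen_smallImage {T : Type*} (V : T → D → ℝ) (c : ℝ) : IsOpen
    (smallImage (κ := κ) V c) := by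
  have : smallImage (κ := κ) V c =
      ⋃ t, {G : κ × D → ℝ | smoothNorm 0 (fun i => ∑ j, V t j * G (i, j)) < c} := by
    ext G; simp [smallImage]
  rw [this]
  exact isOpen_iUnion fun t =>
    isOpen_lt (continuous_smoothNorm.comp (continuous_mulVec_prod V t)) continuous_const

theorem smoothNorm_le_zero_add {ε : ℝ} (hε : 0 ≤ ε) (x : κ → ℝ) :
    smoothNorm ε x ≤ smoothNorm 0 x + √ε := by
  have h0 := smoothNorm_nonneg (ε := 0) x
  refine Real.sqrt_le_iff.2 ⟨by positivity, ?_⟩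
  nlinarith [Real.sq_sqrt hε, sq_smoothNorm le_rfl x, mul_nonneg h0 (Real.sqrt_nonneg ε)]

variable [DecidableEq κ] [DecidableEq D]

/-- A Chernoff bound through Gordon's comparison. On the event, the soft minimum of the first
process is at least `exp (-l (c + √ε + γ))`, and the independent `γ` contributes `exp (l ^ 2 / 2)`.
For the second process `⟨h, v_t⟩ ≥ -‖P h‖`, so its expectation is bounded by a product of two
exponential moments. -/
theorem smallImage_bound_smooth [Nonempty T] {ε β l c k : ℝ} (hε : 0 < ε) (hl : 0 ≤ l) (hβ : 0 < β)
    (hlβ : l ≤ β) {V : T → D → ℝ} (hV : ∀ t, ∑ j, V t j ^ 2 = 1) {P : Matrix D D ℝ}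
    (hP : P.transpose = P) (hPP : P * P = P) (hPV : ∀ t, P.mulVec (V t) = V t)
    (hk : P.trace ≤ k) (hk0 : 0 ≤ k) (hκ : 1 ≤ Fintype.card κ) :
    (stdGauss (κ × D)).real (smallImage V c) * Real.exp (-l * (c + √ε)) * Real.exp (l ^ 2 / 2) ≤
      Real.exp (l / β * Real.log (Fintype.card T)) *
        (Real.exp (-l * √((Fintype.card κ : ℝ) - 1) + l ^ 2 / 4) *
          Real.exp (l * √(k + ε) + l ^ 2 / 2)) := by
  have hG := gordon_softMin (κ := κ) hε hl hβ hlβ hV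
  -- Dropping the nonnegative norm bounds the integrand by a multiple of `exp (l |γ|)`.
  have hintA : Integrable (fun w => softMin ε β l (gordonA κ V w)) (stdGauss (GordonIdx κ D)) := by
    refine (ExpGrowth.of_le (g := fun w => Real.exp (l / β * Real.log (Fintype.card T)) *
      Real.exp (l * |w (.inl (.inr ()))|)) ?_ ?_ fun w => ?_).integrable
    · exact (contDiff_softMin hε (n := 0)).continuous.comp (gordonA κ V).continuous
    · refine (ExpGrowth.const _).mul (.exp_mul (by fun_prop) (a := 0) (c := 1) (fun w => ?_) l)
      rw [abs_abs, zero_add, one_mul]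
      exact Finset.single_le_sum (f := fun i => |w i|) (fun _ _ => abs_nonneg _)
        (Finset.mem_univ _)
    · rw [abs_of_pos (softMin_pos _), abs_of_nonneg (by positivity)]
      have h := softMin_le hβ hl (gordonA κ V w) (ε := ε) (b := -|w (.inl (.inr ()))|) fun t => by
        have h1 : smoothNorm ε ((gordonA κ V w).1 t) + w (.inl (.inr ())) =
          normVal ε (gordonA κ V w) t := rfl
        linarith [smoothNorm_nonneg (ε := ε) ((gordonA κ V w).1 t),
          neg_abs_le (w (.inl (.inr ())))]
      simpa using h
  have hlow : (stdGauss (κ × D)).real (smallImage V c) * Real.exp (-l * (c + √ε))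
      * Real.exp (l ^ 2 / 2) ≤ ∫ w, softMin ε β l (gordonA κ V w) ∂(stdGauss (GordonIdx κ D)) := by
    set F : (κ × D → ℝ) → ℝ := (smallImage V c).indicator fun _ => Real.exp (-l * (c + √ε))
    have hmeas := (isOpen_smallImage (κ := κ) V c).measurableSet
    have e1 : ∫ u, F u ∂(stdGauss (κ × D)) =
        (stdGauss (κ × D)).real (smallImage V c) * Real.exp (-l * (c + √ε)) := by
      rw [integral_indicator_const _ hmeas, smul_eq_mul]
    have hFi : Integrable F (stdGauss (κ × D)) := (integrable_const _).indicator hmeas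
    have e2 := integral_stdGauss_sum_mul (ι := (κ × D) ⊕ Unit) (ι' := κ ⊕ D)
      (fun u => F (fun i => u (.inl i)) * Real.exp (-l * u (.inr ()))) (fun _ => 1)
    rw [integral_stdGauss_sum_mul F (fun v : Unit → ℝ => Real.exp (-l * v ())), e1,
      integral_stdGauss_unit_exp] at e2
    simp only [neg_sq, mul_one, integral_const, probReal_univ, smul_eq_mul] at e2
    rw [← e2]
    refine integral_mono_of_nonneg (Filter.Eventually.of_forall fun w => ?_) hintA
      (Filter.Eventually.of_forall fun w => ?_)
    · exact mul_nonneg (Set.indicator_nonneg (fun _ _ => (Real.exp_pos _).le) _)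
        (Real.exp_pos _).le
    · simp only
      by_cases hw : (fun i => w (.inl (.inl i))) ∈ smallImage (κ := κ) V c
      · obtain ⟨t, ht⟩ := id hw
        have h1 : F (fun i => w (.inl (.inl i))) = Real.exp (-l * (c + √ε)) :=
          Set.indicator_of_mem hw _
        rw [h1, ← Real.exp_add]
        refine le_trans (Real.exp_le_exp.2 ?_) (le_softMin hβ hl _ t)
        have h2 : normVal ε (gordonA κ V w) t ≤ c + √ε + w (.inl (.inr ())) :=
          add_le_add ((smoothNorm_le_zero_add hε.le _).trans (add_le_add ht.le le_rfl)) le_rfl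
        have := mul_le_mul_of_nonneg_left h2 hl
        linarith
      · have h1 : F (fun i => w (.inl (.inl i))) = 0 := Set.indicator_of_notMem hw _
        rw [h1, zero_mul]
        exact (softMin_pos _).le
  have hup : ∫ w, softMin ε β l (gordonB κ V w) ∂(stdGauss (GordonIdx κ D)) ≤
      Real.exp (l / β * Real.log (Fintype.card T)) *
        ((∫ g : κ → ℝ, Real.exp (-l * smoothNorm ε g) ∂(stdGauss κ)) *
          ∫ h : D → ℝ, Real.exp (l * smoothNorm ε (P.mulVec h)) ∂(stdGauss D)) := by
    have e2 := integral_stdGauss_sum_mul (ι := (κ × D) ⊕ Unit) (ι' := κ ⊕ D) (fun _ => 1)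
      (fun u => Real.exp (-l * smoothNorm ε fun i => u (.inl i)) *
        Real.exp (l * smoothNorm ε (P.mulVec fun j => u (.inr j))))
    rw [integral_stdGauss_sum_mul (fun g : κ → ℝ => Real.exp (-l * smoothNorm ε g))
      (fun h : D → ℝ => Real.exp (l * smoothNorm ε (P.mulVec h)))] at e2
    simp only [one_mul, integral_const, probReal_univ, smul_eq_mul] at e2
    rw [← e2, ← integral_const_mul]
    have hexp : ExpGrowth fun w : GordonIdx κ D → ℝ =>
        Real.exp (-l * smoothNorm ε fun i => w (.inr (.inl i))) *
        Real.exp (l * smoothNorm ε (P.mulVec fun j => w (.inr (.inr j)))) := by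
      have hs : ∀ w : GordonIdx κ D → ℝ, (∑ i, |w (.inr (.inl i))|) ≤ ∑ i, |w i| ∧
          (∑ j, |w (.inr (.inr j))|) ≤ ∑ i, |w i| := by
        intro w
        simp only [Fintype.sum_sum_type]
        have h1 : 0 ≤ ∑ i : κ × D, |w (.inl (.inl i))| := Finset.sum_nonneg fun _ _ => abs_nonneg _
        have h2 : 0 ≤ ∑ i : Unit, |w (.inl (.inr i))| := Finset.sum_nonneg fun _ _ => abs_nonneg _
        have h3 : 0 ≤ ∑ i : κ, |w (.inr (.inl i))| := Finset.sum_nonneg fun _ _ => abs_nonneg _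
        have h4 : 0 ≤ ∑ i : D, |w (.inr (.inr i))| := Finset.sum_nonneg fun _ _ => abs_nonneg _
        constructor <;> linarith
      refine .mul (.exp_mul (f := fun w : GordonIdx κ D → ℝ =>
        smoothNorm ε fun i => w (.inr (.inl i))) (continuous_smoothNorm.comp (by fun_prop))
        (a := √ε) (c := 1) (fun w => ?_) (-l))
        (.exp_mul (f := fun w : GordonIdx κ D → ℝ =>
        smoothNorm ε (P.mulVec fun i => w (.inr (.inr i))))
            (continuous_smoothNorm.comp (by fun_prop))
        (a := √ε) (c := ∑ i, ∑ j, |P i j|) (fun w => ?_) l)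
      · rw [abs_of_nonneg (smoothNorm_nonneg _), one_mul]
        exact (smoothNorm_le hε.le _).trans (add_le_add le_rfl (hs w).1)
      · rw [abs_of_nonneg (smoothNorm_nonneg _)]
        refine (smoothNorm_le hε.le _).trans (add_le_add le_rfl ((abs_mulVec_le P _).trans ?_))
        exact mul_le_mul_of_nonneg_left (hs w).2 (by positivity)
    refine integral_mono_of_nonneg (Filter.Eventually.of_forall fun w => (softMin_pos _).le)
      (hexp.integrable.const_mul _) (Filter.Eventually.of_forall fun w => ?_)
    simp only
    rw [← Real.exp_add, show -l * (smoothNorm ε fun i => w (.inr (.inl i))) +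
      l * smoothNorm ε (P.mulVec fun j => w (.inr (.inr j))) =
      -l * ((smoothNorm ε fun i => w (.inr (.inl i))) -
        smoothNorm ε (P.mulVec fun j => w (.inr (.inr j)))) by ring]
    refine softMin_le hβ hl _ fun t => ?_
    set h : D → ℝ := fun j => w (.inr (.inr j)) with hh
    have h1 : normVal ε (gordonB κ V w) t =
        smoothNorm ε (fun i => w (.inr (.inl i))) + V t ⬝ᵥ h := rfl
    -- Only the component of `h` in the subspace is seen by `V t`; this is what produces `√k` in
    -- place of the square root of the ambient dimension.
    have h2 : V t ⬝ᵥ h = V t ⬝ᵥ P.mulVec h := by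
      conv_lhs => rw [← hPV t]
      rw [Matrix.dotProduct_mulVec, ← Matrix.mulVec_transpose, hP]
    have h3 : (V t ⬝ᵥ P.mulVec h) ^ 2 ≤ smoothNorm ε (P.mulVec h) ^ 2 := by
      refine (Finset.sum_mul_sq_le_sq_mul_sq _ _ _).trans ?_
      rw [hV, one_mul]
      exact sum_sq_le_sq_smoothNorm hε.le _
    have h4 := abs_le_of_sq_le_sq' h3 (smoothNorm_nonneg _)
    rw [h1, h2]
    linarith [h4.1]
  refine hlow.trans (hG.trans (hup.trans ?_))
  gcongr
  · exact mgf_neg_smoothNorm_le hε hl hκ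
  · exact mgf_smoothNorm_mulVec_le hε hl hP hPP hk hk0

/-- Take `β = 1 / ε` and let `ε → 0`: the smoothing and the factor depending on `|T|` vanish
together. The factors `exp (l ^ 2 / 2)` from `γ` and from `‖P h‖` cancel, which leaves `l ^ 2 / 4`.
-/
theorem measureReal_smallImage_le_of_fintype [Nonempty T] {l c k : ℝ} (hl : 0 ≤ l)
    {V : T → D → ℝ} (hV : ∀ t, ∑ j, V t j ^ 2 = 1) {P : Matrix D D ℝ}
    (hP : P.transpose = P) (hPP : P * P = P) (hPV : ∀ t, P.mulVec (V t) = V t)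
    (hk : P.trace ≤ k) (hk0 : 0 ≤ k) (hκ : 1 ≤ Fintype.card κ) :
    (stdGauss (κ × D)).real (smallImage V c) ≤
      Real.exp (l * (c + √k - √((Fintype.card κ : ℝ) - 1)) + l ^ 2 / 4) := by
  set p := (stdGauss (κ × D)).real (smallImage V c)
  set s := √((Fintype.card κ : ℝ) - 1)
  have hcl : Filter.Tendsto (fun ε : ℝ => p * Real.exp (-l * (c + √ε)) * Real.exp (l ^ 2 / 2))
      (nhdsWithin 0 (Set.Ioi 0)) (nhds (p * Real.exp (-l * (c + √0)) * Real.exp (l ^ 2 / 2))) :=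
    tendsto_nhdsWithin_of_tendsto_nhds (Continuous.tendsto (by fun_prop) 0)
  have hcr : Filter.Tendsto (fun ε : ℝ => Real.exp (l * ε * Real.log (Fintype.card T)) *
      (Real.exp (-l * s + l ^ 2 / 4) * Real.exp (l * √(k + ε) + l ^ 2 / 2)))
      (nhdsWithin 0 (Set.Ioi 0)) (nhds (Real.exp (l * 0 * Real.log (Fintype.card T)) *
      (Real.exp (-l * s + l ^ 2 / 4) * Real.exp (l * √(k + 0) + l ^ 2 / 2)))) :=
    tendsto_nhdsWithin_of_tendsto_nhds (Continuous.tendsto (by fun_prop) 0)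
  have hev : ∀ᶠ ε : ℝ in nhdsWithin 0 (Set.Ioi 0),
      p * Real.exp (-l * (c + √ε)) * Real.exp (l ^ 2 / 2) ≤
      Real.exp (l * ε * Real.log (Fintype.card T)) *
      (Real.exp (-l * s + l ^ 2 / 4) * Real.exp (l * √(k + ε) + l ^ 2 / 2)) := by
    -- For `ε < 1 / (l + 1)` one has `l ≤ 1 / ε = β`, as the comparison requires.
    filter_upwards [Ioo_mem_nhdsGT (show (0 : ℝ) < (l + 1)⁻¹ by positivity)] with ε hε
    have h := smallImage_bound_smooth (κ := κ) (c := c) hε.1 hl (inv_pos.2 hε.1) (by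
      have := (lt_inv_comm₀ hε.1 (by positivity)).1 hε.2
      linarith) hV hP hPP hPV hk hk0 hκ
    rwa [div_inv_eq_mul] at h
  have h := le_of_tendsto_of_tendsto hcl hcr hev
  simp only [Real.sqrt_zero, add_zero, mul_zero, zero_mul, Real.exp_zero, one_mul] at h
  rw [mul_assoc, ← Real.exp_add, ← Real.exp_add, ← le_div_iff₀ (Real.exp_pos _),
    ← Real.exp_sub] at h
  refine h.trans_eq ?_
  congr 1
  ring

end LassoGaussian

/-! ### The smallest singular value of a Gaussian matrix on a subspace. -/

namespace LassoGaussian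

variable {κ D : Type*} [Fintype κ] [Fintype D] [DecidableEq κ] [DecidableEq D]

/-- The bound for finite families does not depend on their size. Because the defining inequality is
strict, hence open in `v`, the event for the whole sphere is the increasing union of the events for
initial segments of a dense sequence. -/
theorem measureReal_smallImage_le {l c k : ℝ} (hl : 0 ≤ l) {P : Matrix D D ℝ}
    (hP : P.transpose = P) (hPP : P * P = P) (hk : P.trace ≤ k) (hk0 : 0 ≤ k)
    (hκ : 1 ≤ Fintype.card κ) :
    (stdGauss (κ × D)).real
        (smallImage (fun v : {v : D → ℝ // P.mulVec v = v ∧ ∑ j, v j ^ 2 = 1} => v.1) c) ≤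
      Real.exp (l * (c + √k - √((Fintype.card κ : ℝ) - 1)) + l ^ 2 / 4) := by
  set T := {v : D → ℝ // P.mulVec v = v ∧ ∑ j, v j ^ 2 = 1}
  rcases isEmpty_or_nonempty T with hT | hT
  · have : smallImage (κ := κ) (fun v : T => v.1) c = ∅ := by
      ext G; simp [smallImage]
    rw [this, measureReal_empty]
    exact (Real.exp_pos _).le
  set u : ℕ → T := TopologicalSpace.denseSeq T
  set s : ℕ → Set (κ × D → ℝ) := fun m => smallImage (fun t : Fin (m + 1) => (u t).1) c
  have hmono : Monotone s := by
    rintro a b hab G ⟨t, ht⟩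
    exact ⟨Fin.castLE (by omega) t, ht⟩
  have hunion : smallImage (κ := κ) (fun v : T => v.1) c = ⋃ m, s m := by
    ext G
    simp only [Set.mem_iUnion]
    constructor
    · rintro ⟨v, hv⟩
      have hopen : IsOpen {v : T | smoothNorm 0 (fun i => ∑ j, v.1 j * G (i, j)) < c} :=
        isOpen_lt (continuous_smoothNorm.comp ((by fun_prop : Continuous fun v : D → ℝ =>
          fun i => ∑ j, v j * G (i, j)).comp continuous_subtype_val)) continuous_const
      obtain ⟨m, h1⟩ :=
        (TopologicalSpace.denseRange_denseSeq T).exists_mem_open hopen ⟨v, hv⟩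
      exact ⟨m, ⟨m, by omega⟩, h1⟩
    · rintro ⟨m, t, ht⟩
      exact ⟨u t, ht⟩
  have hlim := tendsto_measure_iUnion_atTop (μ := stdGauss (κ × D)) hmono
  rw [← hunion] at hlim
  have hlim' := (ENNReal.tendsto_toReal (measure_ne_top _ _)).comp hlim
  exact le_of_tendsto' hlim' fun m =>
    measureReal_smallImage_le_of_fintype (κ := κ) hl (fun t => (u t).2.2) hP hPP
      (fun t => (u t).2.1) hk hk0 hκ

theorem smoothNorm_zero_smul {ι : Type*} [Fintype ι] {a : ℝ} (ha : 0 ≤ a) (x : ι → ℝ) :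
    smoothNorm 0 (a • x) = a * smoothNorm 0 x := by
  simp only [smoothNorm, zero_add, Pi.smul_apply, smul_eq_mul, mul_pow, ← Finset.mul_sum]
  rw [Real.sqrt_mul (sq_nonneg a), Real.sqrt_sq ha]

/-- A Gaussian matrix restricted to a `k`-dimensional subspace has smallest singular value at least
`√n - √k - t`, outside an event of probability at most `exp (-t ^ 2 / 2)`. -/
theorem measureReal_gaussian_lower_bound_fails_le {t k : ℝ} (ht : 1 ≤ t) {P : Matrix D D ℝ}
    (hP : P.transpose = P) (hPP : P * P = P) (hk : P.trace ≤ k) (hk0 : 0 ≤ k)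
    (hκ : 5 ≤ Fintype.card κ) :
    (stdGauss (κ × D)).real {G | ∃ v : D → ℝ, P.mulVec v = v ∧
        smoothNorm 0 (fun i => ∑ j, v j * G (i, j)) <
          (√(Fintype.card κ : ℝ) - √k - t) * smoothNorm 0 v} ≤ Real.exp (-t ^ 2 / 2) := by
  set n : ℝ := (Fintype.card κ : ℝ) with hn
  have hn5 : (5 : ℝ) ≤ n := by rw [hn]; exact_mod_cast hκ
  set c := √n - √k - t with hc
  have h := measureReal_smallImage_le (κ := κ) (c := c) (l := t) (by linarith) hP hPP hk hk0
    (by omega)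
  refine (measureReal_mono ?_ (measure_ne_top _ _)).trans (h.trans (Real.exp_le_exp.2 ?_))
  · rintro G ⟨v, hv, hlt⟩
    have hpos : 0 < smoothNorm 0 v := by
      rcases (smoothNorm_nonneg (ε := 0) v).eq_or_lt with h0 | h0
      · exfalso
        have hv0 : v = 0 := by
          have h2 := sq_smoothNorm le_rfl v
          rw [← h0] at h2
          funext j
          have h3 := (Finset.sum_eq_zero_iff_of_nonneg fun i _ => sq_nonneg (v i)).1
            (by linarith : ∑ i, v i ^ 2 = 0) j (Finset.mem_univ j)
          simpa using h3
        rw [hv0] at hlt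
        simp [smoothNorm] at hlt
      · exact h0
    have hinv : 0 ≤ (smoothNorm 0 v)⁻¹ := (inv_pos.2 hpos).le
    refine ⟨⟨(smoothNorm 0 v)⁻¹ • v, ?_, ?_⟩, ?_⟩
    · rw [Matrix.mulVec_smul, hv]
    · have h2 := sq_smoothNorm le_rfl ((smoothNorm 0 v)⁻¹ • v)
      rw [smoothNorm_zero_smul hinv, inv_mul_cancel₀ hpos.ne'] at h2
      linarith
    · have h3 : (fun i => ∑ j, ((smoothNorm 0 v)⁻¹ • v) j * G (i, j)) =
          (smoothNorm 0 v)⁻¹ • fun i => ∑ j, v j * G (i, j) := by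
        funext i
        simp [Finset.mul_sum, mul_assoc]
      simp only [h3]
      rw [smoothNorm_zero_smul hinv, inv_mul_lt_iff₀ hpos, mul_comm]
      exact hlt
  · have h1 : √n - √(n - 1) ≤ 1 / 4 := by
      have h2 : 2 ≤ √(n - 1) := by
        rw [show (2 : ℝ) = √4 by rw [show (4 : ℝ) = 2 ^ 2 by norm_num]; simp]
        exact Real.sqrt_le_sqrt (by linarith)
      have h3 : √n ≤ √(n - 1) + 1 / 4 := by
        refine Real.sqrt_le_iff.2 ⟨by positivity, ?_⟩
        nlinarith [Real.sq_sqrt (show 0 ≤ n - 1 by linarith)]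
      linarith
    rw [hc]
    nlinarith

end LassoGaussian

/-! ### The Gaussian ensemble as a linear image of a standard Gaussian matrix. -/

namespace LassoGaussian

theorem map_curry_stdGauss (κ D : Type*) [Fintype κ] [Fintype D] :
    (stdGauss (κ × D)).map (fun G i j => G (i, j)) = Measure.pi fun _ : κ => stdGauss D := by
  have h := Measure.infinitePi_map_curry (ι := κ) (κ := D) (fun _ _ => gaussianReal 0 1)
  simp only [Measure.infinitePi_eq_pi] at h
  exact h

variable {Ω : Type*} [MeasurableSpace Ω] {P : Measure Ω} {n d : ℕ}
  {X : Ω → Matrix (Fin n) (Fin d) ℝ} {S : Matrix (Fin d) (Fin d) ℝ}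

theorem map_gaussian_rows (S : Matrix (Fin d) (Fin d) ℝ) :
    (stdGauss (Fin n × Fin d)).map (fun G i =>
        Matrix.toEuclideanCLM (𝕜 := ℝ) (CFC.sqrt S) (WithLp.toLp 2 fun j => G (i, j))) =
      Measure.pi fun _ : Fin n => multivariateGaussian 0 S := by
  have h1 : (multivariateGaussian 0 S : Measure (EuclideanSpace ℝ (Fin d))) =
      (stdGauss (Fin d)).map fun x =>
        Matrix.toEuclideanCLM (𝕜 := ℝ) (CFC.sqrt S) (WithLp.toLp 2 x) := by
    rw [multivariateGaussian, ← map_pi_eq_stdGaussian, Measure.map_map (by fun_prop) (by fun_prop)]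
    congr 1
    funext x
    simp
  have h2 : Measurable fun x : Fin d → ℝ =>
      Matrix.toEuclideanCLM (𝕜 := ℝ) (CFC.sqrt S) (WithLp.toLp 2 x) := by fun_prop
  rw [h1]
  have : ∀ _ : Fin n, SigmaFinite ((stdGauss (Fin d)).map fun x =>
      Matrix.toEuclideanCLM (𝕜 := ℝ) (CFC.sqrt S) (WithLp.toLp 2 x)) := fun _ => by
    have := Measure.isProbabilityMeasure_map (μ := stdGauss (Fin d)) h2.aemeasurable
    infer_instance
  rw [← Measure.pi_map_pi (fun _ => h2.aemeasurable), ← map_curry_stdGauss,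
    Measure.map_map (by fun_prop) (by fun_prop)]
  rfl

/-- Independence and the row laws determine the joint law, so probabilities of events in the rows
can be computed for `√S` applied to the rows of a standard Gaussian matrix. -/
theorem IsGaussianEnsemble.measureReal_rows [IsProbabilityMeasure P]
    (h : IsGaussianEnsemble X S P) {U : Set (Fin n → EuclideanSpace ℝ (Fin d))}
    (hU : MeasurableSet U) :
    P.real {ω | (fun i => WithLp.toLp 2 (X ω i)) ∈ U} =
      (stdGauss (Fin n × Fin d)).real {G | (fun i =>
        Matrix.toEuclideanCLM (𝕜 := ℝ) (CFC.sqrt S) (WithLp.toLp 2 fun j => G (i, j))) ∈ U} := by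
  have hm : ∀ i, AEMeasurable (fun ω => WithLp.toLp 2 (X ω i)) P := fun i =>
    (h.law i).aemeasurable
  have h1 := (iIndepFun_iff_map_fun_eq_pi_map hm).1 h.indep
  have h2 : P.map (fun ω i => WithLp.toLp 2 (X ω i)) =
      Measure.pi fun _ : Fin n => multivariateGaussian 0 S := by
    rw [h1]; congr 1; funext i; exact (h.law i).map_eq
  rw [← map_gaussian_rows] at h2
  have h3 := congrArg (fun μ => μ.real U) h2
  simp only at h3
  rw [map_measureReal_apply_of_aemeasurable (by fun_prop) hU,
    map_measureReal_apply (by fun_prop) hU] at h3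
  exact h3

end LassoGaussian

/-! ### Deterministic estimates: pseudoinverse, singular values, square roots, Schur complement. -/

namespace LassoGaussian

theorem sq_smoothNorm_zero {ι : Type*} [Fintype ι] (x : ι → ℝ) :
    smoothNorm 0 x ^ 2 = x ⬝ᵥ x := by
  rw [sq_smoothNorm le_rfl, zero_add]
  simp [dotProduct, pow_two]

theorem norm_toLp_eq_smoothNorm {ι : Type*} [Fintype ι] (x : ι → ℝ) :
    ‖(WithLp.toLp 2 x : EuclideanSpace ℝ ι)‖ = smoothNorm 0 x := by
  simp [EuclideanSpace.norm_eq, smoothNorm]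

section Deterministic

variable {m k : Type*} [Fintype m] [Fintype k] [DecidableEq k]

/-- By the Penrose equations `M * B` is symmetric and idempotent, hence an orthogonal projection. -/
theorem IsMoorePenrose.smoothNorm_mulVec_le {k : Type*} [Fintype k] {M : Matrix m k ℝ}
    {B : Matrix k m ℝ}
    (hB : IsMoorePenrose M B) (y : m → ℝ) :
    smoothNorm 0 (M.mulVec (B.mulVec y)) ≤ smoothNorm 0 y := by
  set Q := M * B with hQ
  have hQQ : Q * Q = Q := by rw [hQ, ← Matrix.mul_assoc, hB.mul_mul_self]
  have hQt : Q.transpose = Q := hB.left_symm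
  rw [Matrix.mulVec_mulVec, ← hQ]
  have h1 : y ⬝ᵥ Q.mulVec y = Q.mulVec y ⬝ᵥ Q.mulVec y := by
    conv_lhs => rw [← hQQ, ← Matrix.mulVec_mulVec, Matrix.dotProduct_mulVec,
      ← Matrix.mulVec_transpose, hQt]
  have h2 : 0 ≤ (y - Q.mulVec y) ⬝ᵥ (y - Q.mulVec y) :=
    Finset.sum_nonneg fun _ _ => mul_self_nonneg _
  rw [sub_dotProduct, dotProduct_sub, dotProduct_sub, dotProduct_comm (Q.mulVec y) y, h1] at h2
  refine le_of_sq_le_sq ?_ (smoothNorm_nonneg y)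
  rw [sq_smoothNorm_zero, sq_smoothNorm_zero]
  linarith

/-- With `B = pinv M`: `D ‖B y‖ ≤ ‖M B y‖ ≤ ‖y‖`. -/
theorem specNorm_pinv_le [DecidableEq m] {M : Matrix m k ℝ} {D : ℝ} (hD : 0 < D)
    (h : ∀ u, D * smoothNorm 0 u ≤ smoothNorm 0 (M.mulVec u)) : specNorm (pinv M) ≤ D⁻¹ := by
  refine ContinuousLinearMap.opNorm_le_bound _ (inv_nonneg.2 hD.le) fun y => ?_
  have h1 : (Matrix.toEuclideanLin (pinv M)).toContinuousLinearMap y =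
      WithLp.toLp 2 ((pinv M).mulVec y.ofLp) := rfl
  have h2 : ‖y‖ = smoothNorm 0 y.ofLp := by rw [← norm_toLp_eq_smoothNorm]
  rw [h1, norm_toLp_eq_smoothNorm, h2, ← div_eq_inv_mul, le_div_iff₀ hD, mul_comm]
  exact (h _).trans ((isMoorePenrose_pinv M).smoothNorm_mulVec_le _)

theorem sigmaMin_nonneg (M : Matrix m k ℝ) : 0 ≤ sigmaMin M :=
  LinearMap.singularValues_nonneg _ _

theorem sigmaMin_of_isEmpty [IsEmpty k] (M : Matrix m k ℝ) : sigmaMin M = 0 :=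
  LinearMap.singularValues_of_finrank_le _ (by simp)

/-- Expand `u` in an eigenbasis of `Mᵀ M`: the eigenvalues decrease, so the one with index `card k -
1`, namely `sigmaMin M ^ 2`, is the smallest. -/
theorem sigmaMin_mul_smoothNorm_le (M : Matrix m k ℝ) (u : k → ℝ) :
    sigmaMin M * smoothNorm 0 u ≤ smoothNorm 0 (M.mulVec u) := by
  rcases isEmpty_or_nonempty k with hk | hk
  · rw [sigmaMin_of_isEmpty, zero_mul]; exact smoothNorm_nonneg _
  set T := Matrix.toEuclideanLin M with hT
  have hcard : 0 < Fintype.card k := Fintype.card_pos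
  have hfr : Module.finrank ℝ (EuclideanSpace ℝ k) = Fintype.card k := by simp
  have hs := T.isSymmetric_adjoint_comp_self
  set b := hs.eigenvectorBasis hfr with hb
  set x : EuclideanSpace ℝ k := WithLp.toLp 2 u with hx
  have hlast : sigmaMin M ^ 2 = hs.eigenvalues hfr ⟨Fintype.card k - 1, by omega⟩ :=
    T.sq_singularValues_of_lt hfr (by omega)
  have hTx : ‖T x‖ ^ 2 = ∑ i, hs.eigenvalues hfr i * inner ℝ (b i) x ^ 2 := by
    have h1 : ‖T x‖ ^ 2 = inner ℝ ((LinearMap.adjoint T ∘ₗ T) x) x := by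
      rw [LinearMap.comp_apply, LinearMap.adjoint_inner_left, real_inner_self_eq_norm_sq]
    rw [h1, ← b.sum_inner_mul_inner]
    refine Finset.sum_congr rfl fun i _ => ?_
    have h2 : inner ℝ ((LinearMap.adjoint T ∘ₗ T) x) (b i) =
        hs.eigenvalues hfr i * inner ℝ (b i) x := by
      rw [hs x (b i), hb, hs.apply_eigenvectorBasis hfr i]
      simp [real_inner_smul_right, real_inner_comm]
    rw [h2]; ring
  have hxx : ‖x‖ ^ 2 = ∑ i, inner ℝ (b i) x ^ 2 := by
    rw [← real_inner_self_eq_norm_sq, ← b.sum_inner_mul_inner]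
    refine Finset.sum_congr rfl fun i _ => ?_
    rw [real_inner_comm x (b i), pow_two]
  have hle : sigmaMin M ^ 2 * ‖x‖ ^ 2 ≤ ‖T x‖ ^ 2 := by
    rw [hTx, hxx, Finset.mul_sum, hlast]
    refine Finset.sum_le_sum fun i _ => mul_le_mul_of_nonneg_right ?_ (sq_nonneg _)
    refine hs.eigenvalues_antitone hfr ?_
    rw [Fin.le_def]
    have := i.2
    simp only
    omega
  have hTx' : ‖T x‖ = smoothNorm 0 (M.mulVec u) := norm_toLp_eq_smoothNorm _
  rw [hTx', hx, norm_toLp_eq_smoothNorm, ← mul_pow] at hle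
  exact le_of_sq_le_sq hle (smoothNorm_nonneg _)

theorem maxNorm_le {m k : Type*} {M : Matrix m k ℝ} {b : ℝ} (hb : 0 ≤ b)
    (h : ∀ i j, |M i j| ≤ b) : maxNorm M ≤ b :=
  Real.iSup_le (fun i => Real.iSup_le (fun j => h i j) hb) hb

theorem maxNorm_nonneg {m k : Type*} (M : Matrix m k ℝ) : 0 ≤ maxNorm M :=
  Real.iSup_nonneg fun _ => Real.iSup_nonneg fun _ => abs_nonneg _

theorem sum_abs_le_oneNorm {k : Type*} [Fintype k] (M : Matrix m k ℝ) (j : k) :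
    ∑ i, |M i j| ≤ oneNorm M :=
  le_ciSup (f := fun j => ∑ i, |M i j|) (Set.finite_range _).bddAbove j

theorem oneNorm_nonneg {k : Type*} (M : Matrix m k ℝ) : 0 ≤ oneNorm M :=
  Real.iSup_nonneg fun _ => Finset.sum_nonneg fun _ _ => abs_nonneg _

end Deterministic

section Sqrt

variable {k : Type*} [Fintype k] [DecidableEq k] {S : Matrix k k ℝ}

theorem transpose_sqrt (S : Matrix k k ℝ) : (CFC.sqrt S).transpose = CFC.sqrt S := by
  have h : IsSelfAdjoint (CFC.sqrt S) := (CFC.sqrt_nonneg S).isSelfAdjoint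
  rw [← Matrix.conjTranspose_eq_transpose_of_trivial]
  exact h

theorem sqrt_apply_comm (S : Matrix k k ℝ) (i j : k) : CFC.sqrt S i j = CFC.sqrt S j i :=
  congrFun (congrFun (transpose_sqrt S).symm i) j

theorem sqrt_mul_sqrt (hS : S.PosSemidef) : CFC.sqrt S * CFC.sqrt S = S :=
  CFC.sqrt_mul_sqrt_self S hS.nonneg

theorem sq_smoothNorm_sqrt_mulVec (hS : S.PosSemidef) (u : k → ℝ) :
    smoothNorm 0 ((CFC.sqrt S).mulVec u) ^ 2 = u ⬝ᵥ S.mulVec u := by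
  rw [sq_smoothNorm_zero]
  conv_rhs => rw [← sqrt_mul_sqrt hS, ← Matrix.mulVec_mulVec, Matrix.dotProduct_mulVec,
    ← Matrix.mulVec_transpose, transpose_sqrt]

/-- `S j j` is the squared `ℓ²` norm of column `j` of `√S`, and the `ℓ²` norm is at most the `ℓ¹`
norm. -/
theorem apply_self_le_sq_oneNorm_sqrt (hS : S.PosSemidef) (j : k) :
    S j j ≤ oneNorm (CFC.sqrt S) ^ 2 := by
  set R := CFC.sqrt S
  have h1 : S j j = ∑ i, R i j ^ 2 := by
    conv_lhs => rw [← sqrt_mul_sqrt hS]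
    rw [Matrix.mul_apply]
    refine Finset.sum_congr rfl fun i _ => ?_
    have : R j i = R i j := sqrt_apply_comm S j i
    change R j i * R i j = _
    rw [this, pow_two]
  rw [h1]
  calc ∑ i, R i j ^ 2 = ∑ i, |R i j| ^ 2 := by simp only [sq_abs]
    _ ≤ (∑ i, |R i j|) ^ 2 := Finset.sum_sq_le_sq_sum_of_nonneg fun _ _ => abs_nonneg _
    _ ≤ _ := pow_le_pow_left₀ (Finset.sum_nonneg fun _ _ => abs_nonneg _)
      (sum_abs_le_oneNorm R j) 2

/-- Each diagonal entry is `S j j = ‖√S e_j‖² ≥ σ_min(√S)²`. -/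
theorem card_mul_sq_sigmaMin_sqrt_le_trace (hS : S.PosSemidef) :
    Fintype.card k * sigmaMin (CFC.sqrt S) ^ 2 ≤ S.trace := by
  have h : ∀ j, sigmaMin (CFC.sqrt S) ^ 2 ≤ S j j := by
    intro j
    have h1 := sigmaMin_mul_smoothNorm_le (CFC.sqrt S) (Pi.single j 1)
    have h2 := sq_smoothNorm_sqrt_mulVec hS (Pi.single j 1)
    have h3 : smoothNorm 0 (Pi.single j 1 : k → ℝ) = 1 := by
      simp [smoothNorm, Pi.single_apply]
    rw [h3, mul_one] at h1
    have h4 := pow_le_pow_left₀ (sigmaMin_nonneg _) h1 2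
    rw [h2] at h4
    simpa using h4
  calc Fintype.card k * sigmaMin (CFC.sqrt S) ^ 2 = ∑ _j : k, sigmaMin (CFC.sqrt S) ^ 2 := by
        simp
    _ ≤ _ := Finset.sum_le_sum fun j _ => h j

end Sqrt

section CondCov

variable {d : ℕ} {S : Matrix (Fin d) (Fin d) ℝ} {A : Finset (Fin d)}

theorem posDef_block (hS : S.PosDef) (A : Finset (Fin d)) : (block S A A).PosDef :=
  hS.submatrix Subtype.val_injective

/-- The matrix subtracted from the block is `B D⁻¹ Bᵀ` with `D` positive definite, hence positive
semidefinite. -/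
theorem dotProduct_condCov_le (hS : S.PosDef) (A : Finset (Fin d)) (u : A → ℝ) :
    u ⬝ᵥ (condCov S A).mulVec u ≤ u ⬝ᵥ (block S A A).mulVec u := by
  have hD := (posDef_block hS Aᶜ).inv.posSemidef
  have ht : block S Aᶜ A = (block S A Aᶜ).transpose := by
    ext i j
    have := congrFun (congrFun hS.isHermitian.eq i.1) j.1
    simpa [block] using this.symm
  have h := hD.dotProduct_mulVec_nonneg ((block S Aᶜ A).mulVec u)
  simp only [star_trivial] at h
  have h2 : u ⬝ᵥ (block S A Aᶜ * (block S Aᶜ Aᶜ)⁻¹ * block S Aᶜ A).mulVec u =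
      (block S Aᶜ A).mulVec u ⬝ᵥ ((block S Aᶜ Aᶜ)⁻¹).mulVec ((block S Aᶜ A).mulVec u) := by
    rw [← Matrix.mulVec_mulVec, ← Matrix.mulVec_mulVec, Matrix.dotProduct_mulVec u,
      ← Matrix.mulVec_transpose, ← ht]
  rw [condCov, Matrix.sub_mulVec, dotProduct_sub, h2]
  linarith

theorem posDef_condCov (hS : S.PosDef) (A : Finset (Fin d)) : (condCov S A).PosDef := by
  classical
  have hDpd := posDef_block hS Aᶜ
  have ht : (block S A Aᶜ).conjTranspose = block S Aᶜ A := by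
    ext i j
    have := congrFun (congrFun hS.isHermitian.eq i.1) j.1
    simpa [block] using this
  set e : A ⊕ (Aᶜ : Finset (Fin d)) → Fin d := Sum.elim Subtype.val Subtype.val with he
  have hinj : Function.Injective e := by
    rintro (a | a) (b | b) h
    · exact congrArg _ (Subtype.ext h)
    · exact absurd (show a.1 = b.1 from h) fun h' => (Finset.mem_compl.1 b.2) (h' ▸ a.2)
    · exact absurd (show a.1 = b.1 from h) fun h' => (Finset.mem_compl.1 a.2) (h' ▸ b.2)
    · exact congrArg _ (Subtype.ext h)
  have hpd := hS.submatrix hinj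
  have hblk : S.submatrix e e = Matrix.fromBlocks (block S A A) (block S A Aᶜ)
      (block S A Aᶜ).conjTranspose (block S Aᶜ Aᶜ) := by
    rw [ht]
    ext (i | i) (j | j) <;> rfl
  rw [hblk] at hpd
  have := hDpd.isUnit.invertible
  refine Matrix.PosDef.of_dotProduct_mulVec_pos ?_ fun u hu => ?_
  · have h1 : (block S A A).IsHermitian := (posDef_block hS A).isHermitian
    have h2 : (block S A Aᶜ * (block S Aᶜ Aᶜ)⁻¹ * block S Aᶜ A).IsHermitian := by
      rw [← ht]
      exact Matrix.isHermitian_mul_mul_conjTranspose _ hDpd.inv.isHermitian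
    exact h1.sub h2
  · set D := block S Aᶜ Aᶜ
    set B := block S A Aᶜ
    -- With second component `-D⁻¹ Bᵀ u`, completing the square in the block quadratic form leaves
    -- exactly the Schur complement at `u`.
    have hx : Sum.elim u (-(D⁻¹ * B.conjTranspose).mulVec u) ≠ 0 := fun h0 => hu (by
      funext a; exact congrFun h0 (Sum.inl a))
    have hpos := hpd.dotProduct_mulVec_pos hx
    rw [Matrix.dotProduct_mulVec, Matrix.schur_complement_eq₂₂ _ _ _ _ hDpd.isHermitian,
      add_neg_cancel, dotProduct_zero, zero_add] at hpos
    rw [Matrix.dotProduct_mulVec, condCov, ← ht]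
    exact hpos

end CondCov

end LassoGaussian

/-! ### The two tail events for a Gaussian ensemble. -/

namespace LassoGaussian

variable {Ω : Type*} [MeasurableSpace Ω] {P : Measure Ω} [IsProbabilityMeasure P] {n d : ℕ}
  {X : Ω → Matrix (Fin n) (Fin d) ℝ} {S : Matrix (Fin d) (Fin d) ℝ}

theorem IsGaussianEnsemble.map_apply {P : Measure Ω} (h : IsGaussianEnsemble X S P)
    (hS : S.PosSemidef)
    (i : Fin n) (j : Fin d) :
    AEMeasurable (fun ω => X ω i j) P ∧
      P.map (fun ω => X ω i j) = gaussianReal 0 (S j j).toNNReal := by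
  have h1 := (h.law i).aemeasurable
  have h2 := measurePreserving_eval_multivariateGaussian (μ := 0) hS (i := j)
  refine ⟨h2.measurable.comp_aemeasurable h1, ?_⟩
  have h3 := AEMeasurable.map_map_of_aemeasurable (h2.measurable.aemeasurable) h1
  rw [(h.law i).map_eq, h2.map_eq] at h3
  exact h3.symm

theorem IsGaussianEnsemble.hasSubgaussianMGF {P : Measure Ω} (h : IsGaussianEnsemble X S P)
    (hS : S.PosSemidef)
    (i : Fin n) (j : Fin d) : HasSubgaussianMGF (fun ω => X ω i j) (S j j).toNNReal P := by
  obtain ⟨hm, hmap⟩ := h.map_apply hS i j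
  refine ⟨fun t => ?_, fun t => ?_⟩
  · have h1 := integrable_exp_mul_gaussianReal (μ := 0) (v := (S j j).toNNReal) t
    rw [← hmap] at h1
    exact (integrable_map_measure (by fun_prop) hm).1 h1
  · rw [mgf_gaussianReal hmap]
    simp

theorem IsGaussianEnsemble.measureReal_abs_apply_gt_le (h : IsGaussianEnsemble X S P)
    (hS : S.PosDef) {s : ℝ} (hs : 0 ≤ s) (i : Fin n) (j : Fin d) :
    P.real {ω | oneNorm (CFC.sqrt S) * s < |X ω i j|} ≤ 2 * Real.exp (-s ^ 2 / 2) := by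
  set b := oneNorm (CFC.sqrt S)
  have hb : 0 ≤ b := oneNorm_nonneg _
  have hv : 0 < S j j := hS.diag_pos
  have hvb : S j j ≤ b ^ 2 := apply_self_le_sq_oneNorm_sqrt hS.posSemidef j
  have hsub := h.hasSubgaussianMGF hS.posSemidef i j
  have hle : Real.exp (-(b * s) ^ 2 / (2 * ((S j j).toNNReal : ℝ))) ≤ Real.exp (-s ^ 2 / 2) := by
    refine Real.exp_le_exp.2 ?_
    rw [Real.coe_toNNReal _ hv.le, neg_div, neg_div, neg_le_neg_iff,
      div_le_div_iff₀ two_pos (by positivity)]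
    nlinarith [mul_le_mul_of_nonneg_left hvb (sq_nonneg s)]
  have h1 := (hsub.measure_ge_le (mul_nonneg hb hs)).trans hle
  have h2 := (hsub.neg.measure_ge_le (mul_nonneg hb hs)).trans hle
  calc P.real {ω | b * s < |X ω i j|}
      ≤ P.real ({ω | b * s ≤ X ω i j} ∪ {ω | b * s ≤ (-fun ω => X ω i j) ω}) := by
        refine measureReal_mono (fun ω hω => ?_) (measure_ne_top _ _)
        rcases lt_abs.1 (show b * s < |X ω i j| from hω) with h | h
        · exact Or.inl h.le
        · exact Or.inr h.le
    _ ≤ _ := (measureReal_union_le _ _).trans (add_le_add h1 h2)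
    _ = _ := by ring

/-- The threshold makes each two-sided tail at most `2 * (δ / (4 n d))`; summing over the `n d`
entries gives `δ / 2`. -/
theorem IsGaussianEnsemble.measureReal_exists_abs_apply_gt_le (h : IsGaussianEnsemble X S P)
    (hS : S.PosDef) {δ : ℝ} (hδ : 0 < δ) (hδ1 : δ < 1) (hn : 0 < n) (hd : 0 < d) :
    P.real {ω | ∃ i j, oneNorm (CFC.sqrt S) * √(2 * Real.log (4 * n * d / δ)) < |X ω i j|} ≤
      δ / 2 := by
  have hn' : (1 : ℝ) ≤ n := Nat.one_le_cast.2 hn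
  have hd' : (1 : ℝ) ≤ d := Nat.one_le_cast.2 hd
  have hnd : (1 : ℝ) ≤ n * d := one_le_mul_of_one_le_of_one_le hn' hd'
  set s := √(2 * Real.log (4 * n * d / δ)) with hs
  have hlog : 0 ≤ Real.log (4 * n * d / δ) := by
    refine Real.log_nonneg ?_
    rw [le_div_iff₀ hδ]; nlinarith
  have hexp : Real.exp (-s ^ 2 / 2) = δ / (4 * n * d) := by
    rw [hs, Real.sq_sqrt (by positivity),
      show -(2 * Real.log (4 * n * d / δ)) / 2 = -Real.log (4 * n * d / δ) by ring,
      Real.exp_neg, Real.exp_log (by positivity), inv_div]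
  have hset : {ω | ∃ i j, oneNorm (CFC.sqrt S) * s < |X ω i j|} =
      ⋃ q : Fin n × Fin d, {ω | oneNorm (CFC.sqrt S) * s < |X ω q.1 q.2|} := by
    ext ω; simp
  rw [hset]
  calc _ ≤ ∑ q : Fin n × Fin d, P.real {ω | oneNorm (CFC.sqrt S) * s < |X ω q.1 q.2|} :=
        measureReal_iUnion_fintype_le _
    _ ≤ ∑ _q : Fin n × Fin d, 2 * (δ / (4 * n * d)) := Finset.sum_le_sum fun q _ =>
        (h.measureReal_abs_apply_gt_le hS (Real.sqrt_nonneg _) q.1 q.2).trans_eq (by rw [hexp])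
    _ = δ / 2 := by
        simp
        field_simp
        norm_num

theorem transpose_colSub_sqrt_mul_self (hS : S.PosSemidef) (A : Finset (Fin d)) :
    (colSub (CFC.sqrt S) A).transpose * colSub (CFC.sqrt S) A = block S A A := by
  ext i j
  conv_rhs => rw [block, ← sqrt_mul_sqrt hS]
  simp only [Matrix.mul_apply, Matrix.transpose_apply, Matrix.submatrix_apply, colSub, id]
  exact Finset.sum_congr rfl fun l _ => by rw [sqrt_apply_comm]

theorem sq_smoothNorm_colSub_sqrt (hS : S.PosSemidef) (A : Finset (Fin d)) (u : A → ℝ) :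
    smoothNorm 0 ((colSub (CFC.sqrt S) A).mulVec u) ^ 2 = u ⬝ᵥ (block S A A).mulVec u := by
  rw [sq_smoothNorm_zero, ← transpose_colSub_sqrt_mul_self hS, ← Matrix.mulVec_mulVec,
    Matrix.dotProduct_mulVec u, Matrix.vecMul_transpose]

theorem IsGaussianEnsemble.measureReal_lower_bound_fails_le (h : IsGaussianEnsemble X S P)
    (hS : S.PosDef) (A : Finset (Fin d)) {t : ℝ} (ht : 1 ≤ t) (hn : 5 ≤ n) :
    P.real {ω | ∃ u : A → ℝ, smoothNorm 0 ((colSub (X ω) A).mulVec u) <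
        (√(n : ℝ) - √(A.card : ℝ) - t) * smoothNorm 0 ((colSub (CFC.sqrt S) A).mulVec u)} ≤
      Real.exp (-t ^ 2 / 2) := by
  set c := √(n : ℝ) - √(A.card : ℝ) - t with hc
  set R := colSub (CFC.sqrt S) A with hR
  have hRR : R.transpose * R = block S A A := transpose_colSub_sqrt_mul_self hS.posSemidef A
  have hpd := posDef_block hS A
  have hdet : IsUnit (block S A A).det := (Matrix.isUnit_iff_isUnit_det _).1 hpd.isUnit
  have hinvt : ((block S A A)⁻¹).transpose = (block S A A)⁻¹ := by
    have := hpd.inv.isHermitian.eq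
    rwa [Matrix.conjTranspose_eq_transpose_of_trivial] at this
  -- The orthogonal projection onto the range of `R`. Its trace is `A.card`, the dimension that
  -- enters the singular value bound.
  set Q : Matrix (Fin d) (Fin d) ℝ := R * (block S A A)⁻¹ * R.transpose with hQ
  have hQR : Q * R = R := by
    rw [hQ, Matrix.mul_assoc, hRR, Matrix.mul_assoc, Matrix.nonsing_inv_mul _ hdet, Matrix.mul_one]
  have hQt : Q.transpose = Q := by
    rw [hQ, Matrix.transpose_mul, Matrix.transpose_mul, Matrix.transpose_transpose, hinvt,
      Matrix.mul_assoc]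
  have hQQ : Q * Q = Q := by
    conv_lhs => rw [hQ]
    rw [← hQ, hQ, ← Matrix.mul_assoc, ← Matrix.mul_assoc, ← hQ, hQR]
  have htr : Q.trace = A.card := by
    rw [hQ, Matrix.trace_mul_comm, ← Matrix.mul_assoc, hRR, Matrix.mul_nonsing_inv _ hdet,
      Matrix.trace_one, Fintype.card_coe]
  set U : Set (Fin n → EuclideanSpace ℝ (Fin d)) := {Y | ∃ u : A → ℝ,
    smoothNorm 0 (fun i => ∑ a : A, (Y i) a.1 * u a) < c * smoothNorm 0 (R.mulVec u)} with hU
  have hUo : IsOpen U := by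
    have : U = ⋃ u : A → ℝ, {Y : Fin n → EuclideanSpace ℝ (Fin d) |
        smoothNorm 0 (fun i => ∑ a : A, (Y i) a.1 * u a) < c * smoothNorm 0 (R.mulVec u)} := by
      ext Y; simp [hU]
    rw [this]
    exact isOpen_iUnion fun u =>
      isOpen_lt (continuous_smoothNorm.comp (by fun_prop)) continuous_const
  have h1 := h.measureReal_rows hUo.measurableSet
  have h2 := measureReal_gaussian_lower_bound_fails_le (κ := Fin n) ht hQt hQQ htr.le
    (Nat.cast_nonneg _) (by simpa using hn)
  rw [Fintype.card_fin, ← hc] at h2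
  refine (le_of_eq h1).trans ((measureReal_mono ?_ (measure_ne_top _ _)).trans h2)
  rintro G ⟨u, hu⟩
  refine ⟨R.mulVec u, by rw [Matrix.mulVec_mulVec, hQR], ?_⟩
  convert! hu using 2
  funext i
  -- Row `i` of the matrix is `√S G_i`, so by symmetry of `√S` its `A`-columns send `u` to `G (R
  -- u)`.
  have e : ∀ a : Fin d, (Matrix.toEuclideanCLM (𝕜 := ℝ) (CFC.sqrt S)
      (WithLp.toLp 2 fun j => G (i, j))) a = ∑ l, CFC.sqrt S a l * G (i, l) := fun a => rfl
  simp only [e, Finset.sum_mul, Matrix.mulVec, dotProduct, hR, colSub, Matrix.submatrix_apply, id]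
  rw [Finset.sum_comm]
  exact Finset.sum_congr rfl fun a _ => Finset.sum_congr rfl fun l _ =>
      by rw [sqrt_apply_comm]; ring

/-- Since `2 log 2 > 1`, the deviation `t = √(2 log (2 / δ))` always meets the requirement `1 ≤ t`
of the singular value bound. -/
theorem one_le_sqrt_two_mul_log {δ : ℝ} (hδ : 0 < δ) (hδ1 : δ < 1) :
    1 ≤ √(2 * Real.log (2 / δ)) := by
  have h1 : Real.log 2 ≤ Real.log (2 / δ) :=
    Real.log_le_log two_pos (by rw [le_div_iff₀ hδ]; linarith)
  exact Real.one_le_sqrt.2 (by linarith [Real.log_two_gt_d9])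

/-- With probability at least `1 - δ`, the entries of a Gaussian matrix are small and the column
submatrix with index set `A` is well conditioned. -/
theorem IsGaussianEnsemble.one_sub_le_measureReal (h : IsGaussianEnsemble X S P) (hS : S.PosDef)
    (A : Finset (Fin d)) {δ : ℝ} (hδ : 0 < δ) (hδ1 : δ < 1) (hn : 5 ≤ n) (hd : 0 < d)
    {E : Set Ω} (hE : ∀ ω,
      (∀ i j, |X ω i j| ≤ oneNorm (CFC.sqrt S) * √(2 * Real.log (4 * n * d / δ))) →
      (∀ u : A → ℝ, (√(n : ℝ) - √(A.card : ℝ) - √(2 * Real.log (2 / δ))) *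
        smoothNorm 0 ((colSub (CFC.sqrt S) A).mulVec u) ≤
          smoothNorm 0 ((colSub (X ω) A).mulVec u)) → ω ∈ E) :
    1 - δ ≤ P.real E := by
  set t := √(2 * Real.log (2 / δ)) with ht
  have h1 := h.measureReal_exists_abs_apply_gt_le hS hδ hδ1 (by omega) hd
  have h2 := h.measureReal_lower_bound_fails_le hS A (one_le_sqrt_two_mul_log hδ hδ1) hn
  have hexp : Real.exp (-t ^ 2 / 2) = δ / 2 := by
    have hlog : 0 ≤ Real.log (2 / δ) :=
      Real.log_nonneg (by rw [le_div_iff₀ hδ]; linarith)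
    rw [ht, Real.sq_sqrt (by positivity),
      show -(2 * Real.log (2 / δ)) / 2 = -Real.log (2 / δ) by ring,
      Real.exp_neg, Real.exp_log (by positivity), inv_div]
  rw [← ht, hexp] at h2
  set B1 := {ω | ∃ i j, oneNorm (CFC.sqrt S) * √(2 * Real.log (4 * n * d / δ)) < |X ω i j|}
  set B2 := {ω | ∃ u : A → ℝ, smoothNorm 0 ((colSub (X ω) A).mulVec u) <
        (√(n : ℝ) - √(A.card : ℝ) - t) * smoothNorm 0 ((colSub (CFC.sqrt S) A).mulVec u)}
  -- A covering and subadditivity replace complements, so measurability of `E` is not needed.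
  have hcover : Set.univ ⊆ E ∪ (B1 ∪ B2) := by
    intro ω _
    by_contra hω
    simp only [Set.mem_union, not_or] at hω
    refine hω.1 (hE ω (fun i j => not_lt.1 fun hlt => hω.2.1 ⟨i, j, hlt⟩)
      fun u => not_lt.1 fun hlt => hω.2.2 ⟨u, hlt⟩)
  have h3 : P.real Set.univ ≤ P.real (E ∪ (B1 ∪ B2)) :=
    measureReal_mono hcover (measure_ne_top _ _)
  rw [probReal_univ] at h3
  have h4 := measureReal_union_le (μ := P) E (B1 ∪ B2)
  have h5 := measureReal_union_le (μ := P) B1 B2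
  linarith

/-- A tail bound for `‖X‖_max ‖X_A⁺‖₂`, with the lower bound `D` for the smallest singular value. -/
theorem IsGaussianEnsemble.one_sub_le_measureReal_maxNorm_mul_specNorm
    (h : IsGaussianEnsemble X S P) (hS : S.PosDef)
    (A : Finset (Fin d)) {δ D : ℝ} (hδ : 0 < δ) (hδ1 : δ < 1) (hn : 5 ≤ n) (hd : 0 < d)
    (hD : 0 < D) (hle : ∀ u : A → ℝ, D * smoothNorm 0 u ≤
      (√(n : ℝ) - √(A.card : ℝ) - √(2 * Real.log (2 / δ))) *
        smoothNorm 0 ((colSub (CFC.sqrt S) A).mulVec u)) :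
    1 - δ ≤ P.real {ω | maxNorm (X ω) * specNorm (pinv (colSub (X ω) A)) ≤
      oneNorm (CFC.sqrt S) * √(2 * Real.log (4 * n * d / δ)) / D} := by
  refine h.one_sub_le_measureReal hS A hδ hδ1 hn hd fun ω h1 h2 => ?_
  have hb : 0 ≤ oneNorm (CFC.sqrt S) * √(2 * Real.log (4 * n * d / δ)) :=
    mul_nonneg (oneNorm_nonneg _) (Real.sqrt_nonneg _)
  rw [Set.mem_ofPred_eq, div_eq_mul_inv]
  exact mul_le_mul (maxNorm_le hb h1) (specNorm_pinv_le hD fun u => (hle u).trans (h2 u))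
    (norm_nonneg _) hb

end LassoGaussian

/-! ### The three final bounds. -/

namespace LassoGaussian

variable {Ω : Type*} [MeasurableSpace Ω] {P : Measure Ω} [IsProbabilityMeasure P] {n d : ℕ}
  {X : Ω → Matrix (Fin n) (Fin d) ℝ} {S : Matrix (Fin d) (Fin d) ℝ}

theorem five_le_of_two_lt_sqrt {n : ℕ} (h : 2 < √(n : ℝ)) : 5 ≤ n := by
  have h1 : (2 : ℝ) ^ 2 < n := (Real.lt_sqrt two_pos.le).1 h
  have h2 : (4 : ℝ) < n := by linarith
  exact_mod_cast h2

theorem IsGaussianEnsemble.one_sub_le_measureReal_condCov (h : IsGaussianEnsemble X S P)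
    (hS : S.PosDef) (A : Finset (Fin d)) {δ : ℝ} (hδ : 0 < δ) (hδ1 : δ < 1)
    (hD : 0 < (√(n : ℝ) - √(2 * Real.log (2 / δ))) * sigmaMin (CFC.sqrt (condCov S A))
      - √(condCov S A).trace) :
    1 - δ ≤ P.real {ω | maxNorm (X ω) * specNorm (pinv (colSub (X ω) A)) ≤
      oneNorm (CFC.sqrt S) * √(2 * Real.log (4 * n * d / δ)) /
        ((√(n : ℝ) - √(2 * Real.log (2 / δ))) * sigmaMin (CFC.sqrt (condCov S A))
          - √(condCov S A).trace)} := by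
  have hQ := (posDef_condCov hS A).posSemidef
  set σ := sigmaMin (CFC.sqrt (condCov S A)) with hσ
  set t := √(2 * Real.log (2 / δ)) with ht
  have ht1 : 1 ≤ t := one_le_sqrt_two_mul_log hδ hδ1
  have hσ0 : 0 ≤ σ := sigmaMin_nonneg _
  have htr : √(A.card : ℝ) * σ ≤ √(condCov S A).trace := by
    refine Real.le_sqrt_of_sq_le ?_
    have := card_mul_sq_sigmaMin_sqrt_le_trace hQ
    rwa [Fintype.card_coe, ← hσ, ← Real.sq_sqrt (Nat.cast_nonneg A.card), ← mul_pow] at this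
  -- Replacing `√(Tr S_{A|Aᶜ})` by the smaller `√|A| σ` turns the stated denominator into `σ` times
  -- the Gaussian singular value bound.
  have hc : (√(n : ℝ) - t) * σ - √(condCov S A).trace ≤ (√(n : ℝ) - √(A.card : ℝ) - t) * σ := by
    linarith
  have hcpos : 0 < √(n : ℝ) - √(A.card : ℝ) - t := pos_of_mul_pos_left (hD.trans_le hc) hσ0
  -- For empty `A` the convention `σ = 0` would make the denominator nonpositive. Nonemptiness gives
  -- `√n > √|A| + t ≥ 2`, hence `n ≥ 5`.
  have hA : A.Nonempty := by
    by_contra hA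
    rw [Finset.not_nonempty_iff_eq_empty] at hA
    have : IsEmpty A := by rw [hA]; infer_instance
    have h0 : σ = 0 := sigmaMin_of_isEmpty _
    rw [h0, mul_zero] at hD
    linarith [Real.sqrt_nonneg (condCov S A).trace]
  have hA1 : 1 ≤ √(A.card : ℝ) := Real.one_le_sqrt.2 (Nat.one_le_cast.2 hA.card_pos)
  have hd : 0 < d := by
    obtain ⟨a, -⟩ := hA
    exact a.pos
  refine h.one_sub_le_measureReal_maxNorm_mul_specNorm hS A hδ hδ1
    (five_le_of_two_lt_sqrt (by linarith)) hd hD fun u => ?_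
  have h1 : σ * smoothNorm 0 u ≤ smoothNorm 0 ((colSub (CFC.sqrt S) A).mulVec u) := by
    refine (sigmaMin_mul_smoothNorm_le _ u).trans (le_of_sq_le_sq ?_ (smoothNorm_nonneg _))
    rw [sq_smoothNorm_sqrt_mulVec hQ, sq_smoothNorm_colSub_sqrt hS.posSemidef]
    exact dotProduct_condCov_le hS A u
  calc _ ≤ ((√(n : ℝ) - √(A.card : ℝ) - t) * σ) * smoothNorm 0 u :=
        mul_le_mul_of_nonneg_right hc (smoothNorm_nonneg u)
    _ = (√(n : ℝ) - √(A.card : ℝ) - t) * (σ * smoothNorm 0 u) := mul_assoc _ _ _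
    _ ≤ _ := mul_le_mul_of_nonneg_left h1 hcpos.le

/-- Without columns `maxNorm` is `0` by convention, so any nonnegative bound holds surely; the union
bound over the entries covers only `d > 0`. -/
theorem one_sub_le_measureReal_of_zero_columns {X : Ω → Matrix (Fin n) (Fin d) ℝ} (hd : d = 0)
    {A : Finset (Fin d)} {δ b : ℝ} (hδ : 0 < δ) (hb : 0 ≤ b) :
    1 - δ ≤ P.real {ω | maxNorm (X ω) * specNorm (pinv (colSub (X ω) A)) ≤ b} := by
  have h : {ω | maxNorm (X ω) * specNorm (pinv (colSub (X ω) A)) ≤ b} = Set.univ := by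
    refine Set.eq_univ_of_forall fun ω => ?_
    have h0 : maxNorm (X ω) = 0 := by
      refine le_antisymm (maxNorm_le le_rfl fun _ j => ?_) (maxNorm_nonneg _)
      subst hd; exact j.elim0
    rw [Set.mem_ofPred_eq, h0, zero_mul]
    exact hb
  rw [h, probReal_univ]
  linarith

theorem oneNorm_one [NeZero d] : oneNorm (1 : Matrix (Fin d) (Fin d) ℝ) = 1 := by
  have : ∀ j : Fin d, ∑ i, |(1 : Matrix (Fin d) (Fin d) ℝ) i j| = 1 := fun j => by
    simp [Matrix.one_apply, apply_ite abs]
  simp only [oneNorm, this, ciSup_const]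

theorem inv_sqrt_two_mul_self : (1 / √2 : ℝ) ^ 2 = 1 / 2 := by
  rw [div_pow, Real.sq_sqrt two_pos.le, one_pow]

theorem half_le_inv_sqrt_two : (1 / 2 : ℝ) ≤ 1 / √2 := by
  have h : 0 ≤ 1 / √2 := by positivity
  nlinarith [inv_sqrt_two_mul_self]

theorem IsGaussianEnsemble.one_sub_le_measureReal_one (h : IsGaussianEnsemble X 1 P)
    {A : Finset (Fin d)} (hA : (A.card : ℝ) ≤ n / 2) {δ : ℝ} (hδ : 0 < δ) (hδ1 : δ < 1)
    (hD : 0 < (1 - 1 / √2) * √(n : ℝ) - √(2 * Real.log (2 / δ))) :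
    5 ≤ n ∧ 1 - δ ≤ P.real {ω | maxNorm (X ω) * specNorm (pinv (colSub (X ω) A)) ≤
      √(2 * Real.log (4 * n * d / δ)) /
        ((1 - 1 / √2) * √(n : ℝ) - √(2 * Real.log (2 / δ)))} := by
  set t := √(2 * Real.log (2 / δ)) with ht
  have ht1 : 1 ≤ t := one_le_sqrt_two_mul_log hδ hδ1
  have hn5 : 5 ≤ n := by
    refine five_le_of_two_lt_sqrt ?_
    -- As `1 - 1 / √2 ≤ 1 / 2` and `t ≥ 1`, positivity of the denominator forces `√n > 2`.
    have := mul_le_mul_of_nonneg_right half_le_inv_sqrt_two (Real.sqrt_nonneg (n : ℝ))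
    linarith
  refine ⟨hn5, ?_⟩
  rcases Nat.eq_zero_or_pos d with hd | hd
  · exact one_sub_le_measureReal_of_zero_columns hd hδ (div_nonneg (Real.sqrt_nonneg _) hD.le)
  have : NeZero d := ⟨hd.ne'⟩
  have hk : √(A.card : ℝ) ≤ 1 / √2 * √(n : ℝ) := by
    rw [Real.sqrt_le_iff]
    refine ⟨by positivity, ?_⟩
    rw [mul_pow, inv_sqrt_two_mul_self, Real.sq_sqrt (Nat.cast_nonneg n)]
    linarith
  have h1 := h.one_sub_le_measureReal_maxNorm_mul_specNorm Matrix.PosDef.one A hδ hδ1 hn5 hd hD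
    fun u => by
      have e : smoothNorm 0 ((colSub (CFC.sqrt (1 : Matrix (Fin d) (Fin d) ℝ)) A).mulVec u) =
          smoothNorm 0 u := by
        have hb : block (1 : Matrix (Fin d) (Fin d) ℝ) A A = 1 :=
          Matrix.submatrix_one _ Subtype.val_injective
        have h2 := sq_smoothNorm_colSub_sqrt Matrix.PosSemidef.one A u
        rw [hb, Matrix.one_mulVec, ← sq_smoothNorm_zero] at h2
        exact (sq_eq_sq₀ (smoothNorm_nonneg _) (smoothNorm_nonneg _)).1 h2
      rw [e]
      exact mul_le_mul_of_nonneg_right (by linarith) (smoothNorm_nonneg u)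
  rwa [CFC.sqrt_one, oneNorm_one, one_mul] at h1

theorem IsGaussianEnsemble.one_sub_le_measureReal_bigO (h : IsGaussianEnsemble X 1 P)
    {A : Finset (Fin d)} (hA : (A.card : ℝ) ≤ n / 2) {δ κ : ℝ} (hδ : 0 < δ) (hδ1 : δ < 1)
    (hκ : κ < 1 - 1 / √2) (ht : √(2 * Real.log (2 / δ)) ≤ κ * √(n : ℝ)) :
    1 - δ ≤ P.real {ω | maxNorm (X ω) * specNorm (pinv (colSub (X ω) A)) ≤
      √6 / (1 - 1 / √2 - κ) * √(Real.log (n * d / δ) / n)} := by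
  have hκ' : 0 < 1 - 1 / √2 - κ := by linarith
  rcases Nat.eq_zero_or_pos d with hd | hd
  · exact one_sub_le_measureReal_of_zero_columns hd hδ (by positivity)
  have ht1 := one_le_sqrt_two_mul_log hδ hδ1
  have hn0 : 0 < √(n : ℝ) := by
    refine (Real.sqrt_nonneg _).lt_of_ne fun h0 => ?_
    rw [← h0] at ht
    linarith
  have hDle : (1 - 1 / √2 - κ) * √(n : ℝ) ≤
      (1 - 1 / √2) * √(n : ℝ) - √(2 * Real.log (2 / δ)) := by linarith
  obtain ⟨hn5, h1⟩ := h.one_sub_le_measureReal_one hA hδ hδ1 ((mul_pos hκ' hn0).trans_le hDle)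
  refine h1.trans (measureReal_mono (fun ω hω => ?_) (measure_ne_top _ _))
  rw [Set.mem_ofPred_eq] at hω ⊢
  refine hω.trans ?_
  have hn' : (5 : ℝ) ≤ n := by exact_mod_cast hn5
  have hd' : (1 : ℝ) ≤ d := Nat.one_le_cast.2 hd
  set x : ℝ := n * d / δ with hx
  have hx5 : 5 ≤ x := by
    rw [hx, le_div_iff₀ hδ]
    nlinarith
  -- Here `4 ≤ x ^ 2`, so `4 x ≤ x ^ 3` and the factor `4` is absorbed at the cost of tripling the
  -- logarithm; this is the source of the constant `√6`.
  have hlog : 2 * Real.log (4 * n * d / δ) ≤ 6 * Real.log x := by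
    have e : 4 * n * d / δ = 4 * x := by rw [hx]; ring
    have h2 : Real.log 4 ≤ Real.log (x ^ 2) := Real.log_le_log (by norm_num) (by nlinarith)
    rw [Real.log_pow] at h2
    rw [e, Real.log_mul (by norm_num) (by linarith)]
    push_cast at h2
    linarith
  calc √(2 * Real.log (4 * n * d / δ)) / ((1 - 1 / √2) * √(n : ℝ) - √(2 * Real.log (2 / δ)))
      ≤ √(6 * Real.log x) / ((1 - 1 / √2 - κ) * √(n : ℝ)) :=
        div_le_div₀ (Real.sqrt_nonneg _) (Real.sqrt_le_sqrt hlog) (mul_pos hκ' hn0) hDle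
    _ = √6 / (1 - 1 / √2 - κ) * √(Real.log x / n) := by
        rw [Real.sqrt_mul (by norm_num), Real.sqrt_div (Real.log_nonneg (by linarith))]
        field_simp

end LassoGaussian

theorem mainTheorem6 :
    (∀ (Ω : Type*) [MeasurableSpace Ω] (P : Measure Ω) [IsProbabilityMeasure P] (n d : ℕ)
        (S : Matrix (Fin d) (Fin d) ℝ) (X : Ω → Matrix (Fin n) (Fin d) ℝ)
        (A : Finset (Fin d)) (δ : ℝ),
      S.PosDef → LassoGaussian.IsGaussianEnsemble X S P → A.card ≤ n →
      2 * Real.exp (-(n : ℝ) / 2) < δ → δ < 1 →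
      (LassoGaussian.condCov S A).PosDef ∧
      (0 < (√(n : ℝ) - √(2 * Real.log (2 / δ)))
              * LassoGaussian.sigmaMin (CFC.sqrt (LassoGaussian.condCov S A))
            - √(LassoGaussian.condCov S A).trace →
        1 - δ ≤ P.real {ω |
          LassoGaussian.maxNorm (X ω)
              * LassoGaussian.specNorm (LassoGaussian.pinv (LassoGaussian.colSub (X ω) A)) ≤
            LassoGaussian.oneNorm (CFC.sqrt S) * √(2 * Real.log (4 * n * d / δ))
              / ((√(n : ℝ) - √(2 * Real.log (2 / δ)))
                    * LassoGaussian.sigmaMin (CFC.sqrt (LassoGaussian.condCov S A))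
                  - √(LassoGaussian.condCov S A).trace)})) ∧
    (∀ (Ω : Type*) [MeasurableSpace Ω] (P : Measure Ω) [IsProbabilityMeasure P] (n d : ℕ)
        (X : Ω → Matrix (Fin n) (Fin d) ℝ) (A : Finset (Fin d)) (δ : ℝ),
      LassoGaussian.IsGaussianEnsemble X 1 P → (A.card : ℝ) ≤ n / 2 →
      2 * Real.exp (-(n : ℝ) / 2) < δ → δ < 1 →
      0 < (1 - 1 / √2) * √(n : ℝ) - √(2 * Real.log (2 / δ)) →
        1 - δ ≤ P.real {ω |
          LassoGaussian.maxNorm (X ω)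
              * LassoGaussian.specNorm (LassoGaussian.pinv (LassoGaussian.colSub (X ω) A)) ≤
            √(2 * Real.log (4 * n * d / δ))
              / ((1 - 1 / √2) * √(n : ℝ) - √(2 * Real.log (2 / δ)))}) ∧
    (∀ κ : ℝ, κ < 1 - 1 / √2 → ∃ C : ℝ, 0 < C ∧
      ∀ (Ω : Type*) [MeasurableSpace Ω] (P : Measure Ω) [IsProbabilityMeasure P] (n d : ℕ)
        (X : Ω → Matrix (Fin n) (Fin d) ℝ) (A : Finset (Fin d)) (δ : ℝ),
      LassoGaussian.IsGaussianEnsemble X 1 P → (A.card : ℝ) ≤ n / 2 →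
      2 * Real.exp (-(n : ℝ) / 2) < δ → δ < 1 →
      √(2 * Real.log (2 / δ)) ≤ κ * √(n : ℝ) →
        1 - δ ≤ P.real {ω |
          LassoGaussian.maxNorm (X ω)
              * LassoGaussian.specNorm (LassoGaussian.pinv (LassoGaussian.colSub (X ω) A)) ≤
            C * √(Real.log (n * d / δ) / n)}) := by
  have hpos : ∀ {n : ℕ} {δ : ℝ}, 2 * Real.exp (-(n : ℝ) / 2) < δ → 0 < δ := fun h =>
    (mul_pos two_pos (Real.exp_pos _)).trans h
  refine ⟨?_, ?_, fun κ hκ => ⟨√6 / (1 - 1 / √2 - κ), ?_, ?_⟩⟩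
  · intro Ω _ P _ n d S X A δ hS hX _ hδ hδ1
    exact ⟨LassoGaussian.posDef_condCov hS A,
      hX.one_sub_le_measureReal_condCov hS A (hpos hδ) hδ1⟩
  · intro Ω _ P _ n d X A δ hX hA hδ hδ1 hD
    exact (hX.one_sub_le_measureReal_one hA (hpos hδ) hδ1 hD).2
  · exact div_pos (Real.sqrt_pos.2 (by norm_num)) (by linarith)
  · intro Ω _ P _ n d X A δ hX hA hδ hδ1 ht
    exact hX.one_sub_le_measureReal_bigO hA (hpos hδ) hδ1 hκ ht
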